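/- Let $\Lambda$ be the ring of symmetric functions over $\mathbb Q$ in countably many variables $x_1,x_2,\dots$, with complete homogeneous functions $h_n$, elementary functions $e_n$ (with $h_n=e_n=0$ for $n<0$) and power sums $p_n$; thus $\Lambda=\mathbb Q[p_1,p_2,\dots]$, and $\partial/\partial p_n$ acts on $\Lambda$. Define operators $Y_n$, $Y_n^*$ $(n\in\mathbb Z)$ on $\Lambda$ by $$\sum_{n\in\mathbb Z}Y_nz^{-n}=\exp\Big(\sum_{n\ge1}\frac{p_n}{n}z^n\Big)\exp\Big(-\sum_{n\ge1}(z^{-n}+z^{n})\frac{\partial}{\partial p_n}\Big),$$ $$\sum_{n\in\mathbb Z}Y^*_nz^{n}=(1-z^2)\exp\Big(-\sum_{n\ge1}\frac{p_n}{n}z^n\Big)\exp\Big(\sum_{n\ge1}(z^{-n}+z^{n})\frac{\partial}{\partial p_n}\Big).$$ For a partition $\lambda=(\lambda_1,\dots,\lambda_k)$, $k\ge1$ (trailing zeros allowed), the symplectic Schur function is $sp_\lambda=\frac12\det(h_{\lambda_i-i+j}+h_{\lambda_i-i-j+2})_{1\le i,j\le k}$; the empty partition is written $(0)$, so that $sp_\emptyset=1$.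 Write $\lambda'$ for the conjugate partition and $|\lambda|=\sum_i\lambda_i$. (1) For every partition $\lambda=(\lambda_1,\dots,\lambda_k)$, $$Y^*_{\lambda_1}Y^*_{\lambda_2}\cdots Y^*_{\lambda_k}.1=(-1)^{|\lambda|}\det(e_{\lambda_i-i+j}-e_{\lambda_i-i-j})_{1\le i,j\le k}.$$ (2) For every partition $\lambda$, $$sp_\lambda=\tfrac12\det(h_{\lambda_i-i+j}+h_{\lambda_i-i-j+2})=\det(e_{\lambda'_i-i+j}-e_{\lambda'_i-i-j}),$$ where $\lambda$ and $\lambda'$ may be written with any number of trailing zeros (the first determinant having size at least $1$). (3) For every partition $\lambda=(\alpha|\beta)=(\alpha_1,\dots,\alpha_r|\beta_1,\dots,\beta_r)$ in Frobenius notation, i.e. $r$ is the length of the main diagonal of the Young diagram, $\alpha_i=\lambda_i-i$, $\beta_i=\lambda'_i-i$, and with $|\beta|=\sum_i\beta_i$, $$sp_{(\alpha|\beta)}=(-1)^{|\beta|+r(r-1)/2}\,Y_{-\alpha_1-1}\cdots Y_{-\alpha_r-r}\,Y^*_{\beta_1-(r-1)}Y^*_{\beta_2-(r-2)}\cdots Y^*_{\beta_r}.1,$$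 $$sp_{(\alpha|\beta)}=(-1)^{|\beta|+r(r+1)/2}\,Y^*_{\beta_1+1}\cdots Y^*_{\beta_r+r}\,Y_{-\alpha_1+(r-1)}Y_{-\alpha_2+(r-2)}\cdots Y_{-\alpha_r}.1.$$ -/

import Mathlib

namespace SymFun

/-- The ring of symmetric functions over `ℚ` in the variables `x₀, x₁, x₂, …`: formal power series
of bounded degree that are invariant under all permutations of the variables. -/
noncomputable def symmetricFunctions : Subalgebra ℚ (MvPowerSeries ℕ ℚ) where
  carrier := {f | (∀ s : Equiv.Perm ℕ, MvPowerSeries.renameEquiv ℚ s f = f) ∧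
    ∃ d : ℕ, ∀ m : ℕ →₀ ℕ, d < m.degree → MvPowerSeries.coeff m f = 0}
  mul_mem' := by
    rintro f g ⟨hf, a, ha⟩ ⟨hg, b, hb⟩
    refine ⟨fun s => by rw [map_mul, hf, hg], a + b, fun m hm => ?_⟩
    classical
    rw [MvPowerSeries.coeff_mul]
    refine Finset.sum_eq_zero fun x hx => ?_
    rw [Finset.HasAntidiagonal.mem_antidiagonal] at hx
    have hd : x.1.degree + x.2.degree = m.degree := by rw [← hx, map_add]
    rcases lt_or_ge a x.1.degree with h | h
    · rw [ha _ h, zero_mul]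
    · rw [hb _ (by omega), mul_zero]
  add_mem' := by
    rintro f g ⟨hf, a, ha⟩ ⟨hg, b, hb⟩
    refine ⟨fun s => by rw [map_add, hf, hg], max a b, fun m hm => ?_⟩
    rw [map_add, ha _ (lt_of_le_of_lt (le_max_left _ _) hm),
      hb _ (lt_of_le_of_lt (le_max_right _ _) hm), add_zero]
  algebraMap_mem' := by
    intro r
    refine ⟨fun s => AlgEquiv.commutes _ r, 0, fun m hm => ?_⟩
    classical
    rw [MvPowerSeries.algebraMap_apply, MvPowerSeries.coeff_C, if_neg]
    rintro rfl
    simp at hm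

/-- The ring `Λ` of symmetric functions over `ℚ`. -/
abbrev Lam : Type := ↥symmetricFunctions

theorem coeff_embDomain_of_symm {f : MvPowerSeries ℕ ℚ}
    (hf : ∀ s : Equiv.Perm ℕ, MvPowerSeries.renameEquiv ℚ s f = f)
    (s : Equiv.Perm ℕ) (m : ℕ →₀ ℕ) :
    MvPowerSeries.coeff (m.embDomain s.toEmbedding) f = MvPowerSeries.coeff m f := by
  have h := MvPowerSeries.coeff_embDomain_rename s.toEmbedding f m
  conv_lhs => rw [← hf s]
  exact h

theorem degree_embDomain {σ τ : Type*} (s : σ ↪ τ) (m : σ →₀ ℕ) :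
    (m.embDomain s).degree = m.degree := by
  rw [Finsupp.embDomain_eq_mapDomain, Finsupp.degree_mapDomain]

theorem embDomain_symm (s : Equiv.Perm ℕ) (m : ℕ →₀ ℕ) :
    (m.embDomain s.symm.toEmbedding).embDomain s.toEmbedding = m := by
  rw [Finsupp.embDomain_eq_mapDomain, Finsupp.embDomain_eq_mapDomain, ← Finsupp.mapDomain_comp]
  have : (⇑s.toEmbedding ∘ ⇑s.symm.toEmbedding) = id := by
    ext x; simp
  rw [this, Finsupp.mapDomain_id]

theorem symm_of_coeff {f : MvPowerSeries ℕ ℚ}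
    (h : ∀ (s : Equiv.Perm ℕ) (m : ℕ →₀ ℕ),
      MvPowerSeries.coeff (m.embDomain s.toEmbedding) f = MvPowerSeries.coeff m f)
    (s : Equiv.Perm ℕ) : MvPowerSeries.renameEquiv ℚ s f = f := by
  ext m
  have h1 := MvPowerSeries.coeff_embDomain_rename s.toEmbedding f
    (m.embDomain s.symm.toEmbedding)
  rw [embDomain_symm] at h1
  have h2 := h s (m.embDomain s.symm.toEmbedding)
  rw [embDomain_symm] at h2
  rw [h2]
  exact h1

open Classical in
/-- The symmetric function all of whose monomials satisfying the (permutation invariant, degree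
bounding) predicate `P` have coefficient one, and all of whose other coefficients vanish. -/
noncomputable def ofMonomials (P : (ℕ →₀ ℕ) → Prop)
    (hP : ∀ (s : Equiv.Perm ℕ) (m : ℕ →₀ ℕ), P (m.embDomain s.toEmbedding) ↔ P m)
    (hd : ∃ d : ℕ, ∀ m, P m → m.degree ≤ d) : Lam :=
  ⟨fun m => if P m then 1 else 0, by
    refine ⟨symm_of_coeff fun s m => ?_, ?_⟩
    · change (if P _ then (1 : ℚ) else 0) = if P m then 1 else 0
      rw [hP]
    · obtain ⟨d, hd⟩ := hd
      exact ⟨d, fun m hm => if_neg fun h => absurd (hd m h) (not_le.mpr hm)⟩⟩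

/-- The power sum `p_n = ∑ i, x_i ^ n` (used for `n ≥ 1` only). -/
noncomputable def p (n : ℕ) : Lam :=
  ofMonomials (fun m => ∃ i, m = Finsupp.single i n)
    (fun s m => by
      constructor
      · rintro ⟨i, hi⟩
        refine ⟨s.symm i, Finsupp.embDomain_injective s.toEmbedding ?_⟩
        rw [hi, Finsupp.embDomain_single]; simp
      · rintro ⟨i, rfl⟩
        exact ⟨s i, by rw [Finsupp.embDomain_single]; rfl⟩)
    ⟨n, by rintro m ⟨i, rfl⟩; simp⟩

/-- The complete homogeneous symmetric function `h_n`, the sum of all monomials of degree `n`;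
it is zero for `n < 0`. -/
noncomputable def h (n : ℤ) : Lam :=
  ofMonomials (fun m => (m.degree : ℤ) = n) (fun s m => by rw [degree_embDomain])
    ⟨n.toNat, fun m hm => by omega⟩

/-- The elementary symmetric function `e_n`, the sum of all squarefree monomials of degree `n`;
it is zero for `n < 0`. -/
noncomputable def e (n : ℤ) : Lam :=
  ofMonomials (fun m => (m.degree : ℤ) = n ∧ ∀ i, m i ≤ 1)
    (fun s m => by
      rw [degree_embDomain]
      refine and_congr_right fun _ => ⟨fun H i => ?_, fun H i => ?_⟩
      · have := H (s i)
        rwa [show s i = s.toEmbedding i from rfl, Finsupp.embDomain_apply_self] at this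
      · have := H (s.symm i)
        rw [← Finsupp.embDomain_apply_self s.toEmbedding] at this
        simpa using this)
    ⟨n.toNat, fun m hm => by omega⟩

/-- The map `ℚ[X₁, X₂, …] → Λ`, `X_n ↦ p_n`. -/
noncomputable def powerSumHom : MvPolynomial ℕ+ ℚ →ₐ[ℚ] Lam :=
  MvPolynomial.aeval fun n : ℕ+ => p n

/-- Restriction to the first `N` variables. -/
noncomputable def res (N : ℕ) : Lam →ₐ[ℚ] MvPowerSeries (Fin N) ℚ :=
  (MvPowerSeries.killCompl (R := ℚ) Fin.valEmbedding).comp symmetricFunctions.val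

theorem coeff_res (N : ℕ) (f : Lam) (m : Fin N →₀ ℕ) :
    MvPowerSeries.coeff m (res N f) =
      MvPowerSeries.coeff (m.embDomain Fin.valEmbedding) (f : MvPowerSeries ℕ ℚ) :=
  MvPowerSeries.coeff_killCompl _ _

theorem res_p (N n : ℕ) (hn : 0 < n) :
    res N (p n) = ((MvPolynomial.psum (Fin N) ℚ n : MvPolynomial (Fin N) ℚ) :
      MvPowerSeries (Fin N) ℚ) := by
  classical
  ext m
  rw [coeff_res, MvPolynomial.coeff_coe, MvPolynomial.psum, MvPolynomial.coeff_sum]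
  simp only [MvPolynomial.coeff_X_pow]
  change (if _ then (1 : ℚ) else 0) = _
  split_ifs with H
  · obtain ⟨i, hi⟩ := H
    have hiN : i ∈ Set.range (Fin.valEmbedding (n := N)) := by
      by_contra hc
      have := Finsupp.embDomain_of_notMem_range Fin.valEmbedding m i hc
      rw [hi] at this
      simp at this
      omega
    obtain ⟨j, rfl⟩ := hiN
    rw [← Finsupp.embDomain_single] at hi
    have hm := Finsupp.embDomain_injective _ hi
    subst hm
    rw [Finset.sum_eq_single j]
    · simp
    · intro b _ hb
      rw [if_neg]
      intro hc
      exact hb ((Finsupp.single_left_inj hn.ne').mp hc)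
    · simp
  · symm
    refine Finset.sum_eq_zero fun i _ => if_neg ?_
    rintro rfl
    exact H ⟨i, by rw [Finsupp.embDomain_single]; rfl⟩

/-- The map sending `X_i` to the power sum `p_{i+1}` in `N` variables. -/
noncomputable def finHom (N : ℕ) :
    MvPolynomial (Fin N) ℚ →ₐ[ℚ] MvPolynomial.symmetricSubalgebra (Fin N) ℚ :=
  MvPolynomial.aeval fun i => ⟨MvPolynomial.psum (Fin N) ℚ (i + 1), MvPolynomial.psum_isSymmetric _ _ _⟩

theorem esymm_mem_range (N k : ℕ) (hk : k ≤ N) :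
    (⟨MvPolynomial.esymm (Fin N) ℚ k, MvPolynomial.esymm_isSymmetric _ _ _⟩ :
      MvPolynomial.symmetricSubalgebra (Fin N) ℚ) ∈ (finHom N).range := by
  induction k using Nat.strong_induction_on with
  | _ k ih =>
    rcases Nat.eq_zero_or_pos k with rfl | hk0
    · convert! (finHom N).range.one_mem
      exact Subtype.ext (MvPolynomial.esymm_zero (Fin N) ℚ)
    have hN := MvPolynomial.mul_esymm_eq_sum (Fin N) ℚ k
    have key : (⟨MvPolynomial.esymm (Fin N) ℚ k, MvPolynomial.esymm_isSymmetric _ _ _⟩ :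
        MvPolynomial.symmetricSubalgebra (Fin N) ℚ) = (k : ℚ)⁻¹ • ((-1) ^ (k + 1) *
        ∑ a ∈ Finset.HasAntidiagonal.antidiagonal k with a.1 < k,
          (-1) ^ a.1 * (⟨MvPolynomial.esymm (Fin N) ℚ a.1, MvPolynomial.esymm_isSymmetric _ _ _⟩ :
            MvPolynomial.symmetricSubalgebra (Fin N) ℚ) *
            ⟨MvPolynomial.psum (Fin N) ℚ a.2, MvPolynomial.psum_isSymmetric _ _ _⟩) := by
      apply Subtype.ext
      have hk' : (k : ℚ) ≠ 0 := by exact_mod_cast hk0.ne'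
      have : MvPolynomial.esymm (Fin N) ℚ k =
          (k : ℚ)⁻¹ • ((k : MvPolynomial (Fin N) ℚ) * MvPolynomial.esymm (Fin N) ℚ k) := by
        rw [← nsmul_eq_mul, ← Nat.cast_smul_eq_nsmul ℚ, smul_smul, inv_mul_cancel₀ hk', one_smul]
      refine this.trans ?_
      rw [hN]
      simp
    rw [key]
    refine Subalgebra.smul_mem _ (Subalgebra.mul_mem _ ?_ (Subalgebra.sum_mem _ fun a ha => ?_)) _
    · exact Subalgebra.pow_mem _ (Subalgebra.neg_mem _ (Subalgebra.one_mem _)) _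
    · rw [Finset.mem_filter, Finset.HasAntidiagonal.mem_antidiagonal] at ha
      refine Subalgebra.mul_mem _ (Subalgebra.mul_mem _ ?_ (ih _ ha.2 (by omega))) ?_
      · exact Subalgebra.pow_mem _ (Subalgebra.neg_mem _ (Subalgebra.one_mem _)) _
      · refine ⟨MvPolynomial.X ⟨a.2 - 1, by omega⟩, ?_⟩
        simp only [finHom, RingHom.coe_coe, AlgHom.toRingHom_eq_coe, MvPolynomial.aeval_X]
        apply Subtype.ext
        change MvPolynomial.psum (Fin N) ℚ (a.2 - 1 + 1) = MvPolynomial.psum (Fin N) ℚ a.2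
        rw [Nat.sub_add_cancel (by omega)]

theorem finHom_surjective (N : ℕ) : Function.Surjective (finHom N) := by
  intro x
  obtain ⟨q, rfl⟩ := MvPolynomial.esymmAlgHom_surjective (σ := Fin N) ℚ (n := N) (by simp) x
  have : (MvPolynomial.esymmAlgHom (Fin N) ℚ N).range ≤ (finHom N).range := by
    rw [MvPolynomial.esymmAlgHom, ← Algebra.adjoin_range_eq_range_aeval, Algebra.adjoin_le_iff]
    rintro _ ⟨i, rfl⟩
    exact esymm_mem_range N _ i.2
  exact this ⟨q, rfl⟩

theorem injective_of_surjective_ring {R : Type*} [CommRing R] [IsNoetherianRing R] (f : R →+* R)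
    (hf : Function.Surjective f) : Function.Injective f := by
  let g : ℕ →o Ideal R := ⟨fun n => RingHom.ker (f ^ n), monotone_nat_of_le_succ fun n x hx => by
    rw [RingHom.mem_ker] at hx ⊢
    rw [pow_succ', RingHom.mul_def, RingHom.comp_apply, hx, map_zero]⟩
  obtain ⟨n, hn⟩ := monotone_stabilizes_iff_noetherian.mpr ‹IsNoetherianRing R› g
  have hsurj : Function.Surjective (f ^ n) := by
    rw [RingHom.coe_pow]
    exact hf.iterate n
  rw [injective_iff_map_eq_zero]
  intro x hx
  obtain ⟨y, rfl⟩ := hsurj x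
  have h1 : y ∈ g (n + 1) := by
    change y ∈ RingHom.ker (f ^ (n + 1))
    rw [RingHom.mem_ker, pow_succ', RingHom.mul_def, RingHom.comp_apply, hx]
  rw [← hn (n + 1) (Nat.le_succ n)] at h1
  exact h1

theorem finHom_injective (N : ℕ) : Function.Injective (finHom N) := by
  let E := MvPolynomial.esymmAlgEquiv (Fin N) ℚ (n := N) (by simp)
  have h := injective_of_surjective_ring (E.symm.toAlgHom.comp (finHom N)).toRingHom
    (E.symm.surjective.comp (finHom_surjective N))
  exact Function.Injective.of_comp (f := E.symm) h

theorem res_powerSumHom_rename (N : ℕ) (q : MvPolynomial (Fin N) ℚ) :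
    res N (powerSumHom (MvPolynomial.rename (fun i : Fin N => Nat.succPNat i) q)) =
      ((finHom N q : MvPolynomial (Fin N) ℚ) : MvPowerSeries (Fin N) ℚ) := by
  have : ((res N).comp (powerSumHom.comp
      (MvPolynomial.rename (fun i : Fin N => Nat.succPNat i)))) =
      (MvPolynomial.coeToMvPowerSeries.algHom (R := ℚ) ℚ).comp
        ((MvPolynomial.symmetricSubalgebra (Fin N) ℚ).val.comp (finHom N)) := by
    refine MvPolynomial.algHom_ext fun i => ?_
    simp only [AlgHom.comp_apply, MvPolynomial.rename_X, powerSumHom, finHom,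
      MvPolynomial.aeval_X]
    rw [res_p _ _ (PNat.pos _)]
    simp
  have h := DFunLike.congr_fun this q
  simpa using h

theorem exists_rename_succPNat (P : MvPolynomial ℕ+ ℚ) :
    ∃ (N : ℕ) (q : MvPolynomial (Fin N) ℚ),
      P = MvPolynomial.rename (fun i : Fin N => Nat.succPNat i) q := by
  obtain ⟨s, q, rfl⟩ := MvPolynomial.exists_finset_rename P
  have hlt : ∀ x : {x // x ∈ s}, PNat.natPred x.1 < s.sup (fun n => (n : ℕ)) := by
    intro x
    have h1 : (x.1 : ℕ) ≤ s.sup (fun n => (n : ℕ)) :=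
      Finset.le_sup (f := fun n : ℕ+ => (n : ℕ)) x.2
    have h2 := PNat.natPred_add_one x.1
    omega
  refine ⟨s.sup (fun n => (n : ℕ)), MvPolynomial.rename (fun x : {x // x ∈ s} =>
    ⟨PNat.natPred x.1, hlt x⟩) q, ?_⟩
  rw [MvPolynomial.rename_rename]
  congr 2
  ext x
  simp

theorem powerSumHom_injective : Function.Injective powerSumHom := by
  rw [injective_iff_map_eq_zero]
  intro P hP
  obtain ⟨N, q, rfl⟩ := exists_rename_succPNat P
  have h := res_powerSumHom_rename N q
  rw [hP, map_zero] at h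
  have h' : finHom N q = 0 := by
    apply Subtype.ext
    apply MvPolynomial.coe_injective
    rw [← h]
    simp
  rw [(injective_iff_map_eq_zero (finHom N)).mp (finHom_injective N) q h', map_zero]

/-- All monomials of `f` have degree `d`. -/
def IsHom (f : Lam) (d : ℕ) : Prop :=
  ∀ m : ℕ →₀ ℕ, MvPowerSeries.coeff m (f : MvPowerSeries ℕ ℚ) ≠ 0 → m.degree = d

theorem IsHom.mul {f g : Lam} {a b : ℕ} (hf : IsHom f a) (hg : IsHom g b) :
    IsHom (f * g) (a + b) := by
  classical
  intro m hm
  rw [Subalgebra.coe_mul, MvPowerSeries.coeff_mul] at hm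
  obtain ⟨x, hx, hne⟩ := Finset.exists_ne_zero_of_sum_ne_zero hm
  rw [Finset.HasAntidiagonal.mem_antidiagonal] at hx
  rw [← hx, map_add, hf _ (left_ne_zero_of_mul hne), hg _ (right_ne_zero_of_mul hne)]

theorem isHom_algebraMap (c : ℚ) : IsHom (algebraMap ℚ Lam c) 0 := by
  classical
  intro m hm
  rw [Subalgebra.coe_algebraMap, MvPowerSeries.algebraMap_apply, MvPowerSeries.coeff_C] at hm
  by_contra h
  refine hm (if_neg ?_)
  rintro rfl
  simp at h

theorem isHom_p (n : ℕ) : IsHom (p n) n := by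
  intro m hm
  by_contra h
  refine hm (if_neg ?_)
  rintro ⟨i, rfl⟩
  simp at h

theorem isHom_powerSumHom_monomial (t : ℕ+ →₀ ℕ) (c : ℚ) :
    ∃ d, IsHom (powerSumHom (MvPolynomial.monomial t c)) d := by
  induction t using Finsupp.induction_linear generalizing c with
  | zero => exact ⟨0, by simpa [powerSumHom] using isHom_algebraMap c⟩
  | add s t hs ht =>
    obtain ⟨a, ha⟩ := hs c
    obtain ⟨b, hb⟩ := ht 1
    refine ⟨a + b, ?_⟩
    have := ha.mul hb
    rwa [← map_mul, MvPolynomial.monomial_mul, mul_one] at this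
  | single i k =>
    have hp : ∀ k : ℕ, IsHom (p i ^ k) (k * i) := by
      intro k
      induction k with
      | zero => simpa using isHom_algebraMap 1
      | succ k ih => simpa [pow_succ, add_mul] using ih.mul (isHom_p i)
    refine ⟨0 + k * i, ?_⟩
    have := (isHom_algebraMap c).mul (hp k)
    simpa [powerSumHom, MvPolynomial.aeval_monomial] using this

open Classical in
/-- The homogeneous component of degree `d`. -/
noncomputable def hc (d : ℕ) (f : Lam) : Lam :=
  ⟨fun m => if m.degree = d then MvPowerSeries.coeff m (f : MvPowerSeries ℕ ℚ) else 0, by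
    refine ⟨symm_of_coeff fun s m => ?_, d, fun m hm => if_neg hm.ne'⟩
    change (if _ then _ else _) = (if _ then _ else _)
    rw [degree_embDomain, coeff_embDomain_of_symm f.2.1]⟩

open Classical in
theorem coeff_hc (d : ℕ) (f : Lam) (m : ℕ →₀ ℕ) :
    MvPowerSeries.coeff m (hc d f : MvPowerSeries ℕ ℚ) =
      if m.degree = d then MvPowerSeries.coeff m (f : MvPowerSeries ℕ ℚ) else 0 := rfl

theorem hc_add (d : ℕ) (f g : Lam) : hc d (f + g) = hc d f + hc d g := by
  apply Subtype.ext
  ext m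
  simp only [Subalgebra.coe_add, map_add, coeff_hc]
  split_ifs <;> simp

theorem hc_mem_range (d : ℕ) (P : MvPolynomial ℕ+ ℚ) :
    hc d (powerSumHom P) ∈ powerSumHom.range := by
  induction P using MvPolynomial.induction_on' with
  | monomial t c =>
    obtain ⟨a, ha⟩ := isHom_powerSumHom_monomial t c
    have : hc d (powerSumHom (MvPolynomial.monomial t c)) = powerSumHom (MvPolynomial.monomial t c)
        ∨ hc d (powerSumHom (MvPolynomial.monomial t c)) = 0 := by
      by_cases had : a = d
      · left
        apply Subtype.ext
        ext m
        rw [coeff_hc]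
        split_ifs with hm
        · rfl
        · by_contra hne
          exact hm (had ▸ ha m (Ne.symm hne))
      · right
        apply Subtype.ext
        ext m
        rw [coeff_hc]
        split_ifs with hm
        · by_contra hne
          exact had ((ha m hne).symm.trans hm)
        · simp
    rcases this with h | h
    · rw [h]; exact ⟨_, rfl⟩
    · rw [h]; exact powerSumHom.range.zero_mem
  | add P Q hP hQ => rw [map_add, hc_add]; exact powerSumHom.range.add_mem hP hQ

/-- A homogeneous symmetric function of degree `d` that vanishes in `d` variables is zero. -/
theorem eq_zero_of_res_eq_zero {f : Lam} {d : ℕ} (hf : IsHom f d) (h : res d f = 0) : f = 0 := by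
  apply Subtype.ext
  ext m
  by_contra hne
  have hd := hf m hne
  have hcard : m.support.card ≤ d := by
    rw [← hd, Finsupp.degree_apply]
    calc m.support.card = ∑ i ∈ m.support, 1 := by simp
      _ ≤ _ := Finset.sum_le_sum fun i hi => Nat.one_le_iff_ne_zero.mpr (by simpa using hi)
  obtain ⟨t, ht, htc⟩ : ∃ t ⊆ Finset.range d, t.card = m.support.card :=
    Finset.exists_subset_card_eq (by simpa using hcard)
  obtain ⟨s, hs⟩ : ∃ s : Equiv.Perm ℕ, ∀ i ∈ m.support, s i ∈ t := by
    let e0 : {x // x ∈ m.support} ≃ {x // x ∈ t} := Fintype.equivOfCardEq (by simp [htc])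
    refine ⟨e0.extendSubtype, fun i hi => ?_⟩
    exact e0.extendSubtype_mem i hi
  have h1 := coeff_embDomain_of_symm f.2.1 s m
  have h2 : ((m.embDomain s.toEmbedding).support : Set ℕ) ⊆
      Set.range (Fin.valEmbedding (n := d)) := by
    intro j hj
    rw [Finsupp.support_embDomain] at hj
    simp only [Finset.coe_map, Set.mem_image] at hj
    obtain ⟨i, hi, rfl⟩ := hj
    exact ⟨⟨s i, by simpa using ht (hs i hi)⟩, rfl⟩
  rw [← Finsupp.embDomain_comapDomain h2, ← coeff_res, h] at h1
  apply hne
  rw [← h1]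
  simp

theorem res_symm (N : ℕ) (f : Lam) (q : MvPolynomial (Fin N) ℚ)
    (hq : (q : MvPowerSeries (Fin N) ℚ) = res N f) : q.IsSymmetric := by
  intro s
  have hs : ∀ m : Fin N →₀ ℕ, MvPolynomial.coeff (m.embDomain s.toEmbedding) q =
      MvPolynomial.coeff m q := by
    intro m
    rw [← MvPolynomial.coeff_coe, ← MvPolynomial.coeff_coe, hq, coeff_res, coeff_res]
    let s' : Equiv.Perm ℕ := s.extendDomain Fin.equivSubtype
    rw [← coeff_embDomain_of_symm f.2.1 s' (m.embDomain Fin.valEmbedding)]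
    congr 2
    simp only [Finsupp.embDomain_eq_mapDomain, ← Finsupp.mapDomain_comp]
    congr 1
    ext i
    have := s.extendDomain_apply_image Fin.equivSubtype i
    exact this.symm
  ext m
  have hm : m = (m.embDomain s.symm.toEmbedding).embDomain s.toEmbedding := by
    rw [Finsupp.embDomain_eq_mapDomain, Finsupp.embDomain_eq_mapDomain, ← Finsupp.mapDomain_comp]
    have : (⇑s.toEmbedding ∘ ⇑s.symm.toEmbedding) = id := by
      ext x; simp
    rw [this, Finsupp.mapDomain_id]
  rw [hm, hs, Finsupp.embDomain_eq_mapDomain]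
  exact MvPolynomial.coeff_rename_mapDomain _ s.injective _ _

theorem mem_range_of_isHom {f : Lam} {d : ℕ} (hf : IsHom f d) : f ∈ powerSumHom.range := by
  classical
  obtain ⟨q, hq⟩ : ∃ q : MvPolynomial (Fin d) ℚ, (q : MvPowerSeries (Fin d) ℚ) = res d f := by
    refine ⟨MvPowerSeries.truncTotal (d + 1) (res d f), ?_⟩
    ext m
    rw [MvPolynomial.coeff_coe, MvPowerSeries.coeff_truncTotal_eq_ite]
    split_ifs with hm
    · rfl
    · by_contra hne
      rw [eq_comm, coeff_res] at hne
      have := hf _ hne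
      rw [degree_embDomain] at this
      omega
  obtain ⟨Q, hQ⟩ := finHom_surjective d ⟨q, res_symm d f q hq⟩
  set F := powerSumHom (MvPolynomial.rename (fun i : Fin d => Nat.succPNat i) Q) with hF
  have hres : res d F = res d f := by
    rw [hF, res_powerSumHom_rename, hQ, ← hq]
  have hmem : hc d F ∈ powerSumHom.range := hc_mem_range d _
  have : f - hc d F = 0 := by
    refine eq_zero_of_res_eq_zero (d := d) ?_ ?_
    · intro m hm
      by_contra hmd
      apply hm
      rw [Subalgebra.coe_sub, map_sub, coeff_hc, if_neg hmd, sub_zero]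
      by_contra hne
      exact hmd (hf m hne)
    · ext m
      rw [map_sub, map_sub, coeff_res, coeff_res, coeff_hc, degree_embDomain]
      split_ifs with hm
      · rw [← coeff_res, ← coeff_res, hres]; simp
      · have : MvPowerSeries.coeff (m.embDomain Fin.valEmbedding) (f : MvPowerSeries ℕ ℚ) = 0 := by
          by_contra hne
          exact hm (by rw [← degree_embDomain Fin.valEmbedding, hf _ hne])
        rw [this]; simp
  rw [sub_eq_zero.mp this]
  exact hmem

theorem powerSumHom_surjective : Function.Surjective powerSumHom := by
  intro f
  obtain ⟨d, hd⟩ := f.2.2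
  have : f = ∑ i ∈ Finset.range (d + 1), hc i f := by
    apply Subtype.ext
    ext m
    rw [AddSubmonoidClass.coe_finsetSum, map_sum]
    simp only [coeff_hc]
    rw [Finset.sum_ite_eq]
    split_ifs with hm
    · rfl
    · exact hd m (by simpa using hm)
  rw [this]
  refine powerSumHom.range.sum_mem fun i _ => mem_range_of_isHom (d := i) ?_
  intro m hm
  by_contra hne
  exact hm (if_neg hne)

/-- The isomorphism `ℚ[X₁, X₂, …] ≃ Λ`, `X_n ↦ p_n`. -/
noncomputable def powerSumEquiv : MvPolynomial ℕ+ ℚ ≃ₐ[ℚ] Lam :=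
  AlgEquiv.ofBijective powerSumHom ⟨powerSumHom_injective, powerSumHom_surjective⟩

theorem powerSumEquiv_X (n : ℕ+) : powerSumEquiv (MvPolynomial.X n) = p n := by
  simp [powerSumEquiv, powerSumHom]

/-- The partial derivative `∂/∂p_n` on `Λ = ℚ[p₁, p₂, …]`. -/
noncomputable def pderiv (n : ℕ+) : Lam →ₗ[ℚ] Lam :=
  powerSumEquiv.toLinearMap ∘ₗ (MvPolynomial.pderiv (R := ℚ) n).toLinearMap ∘ₗ
    powerSumEquiv.symm.toLinearMap

/-- The series `exp (s * ∑_{n ≥ 1} (p_n / n) z ^ n)` in `Λ[[z]]`, seen in `Λ((z))`. -/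
noncomputable def expMul (s : ℚ) : LaurentSeries Lam :=
  HahnSeries.ofPowerSeries ℤ Lam
    ((PowerSeries.exp ℚ).subst (PowerSeries.mk fun n : ℕ => (s / (n : ℚ)) • p n : PowerSeries Lam))

/-- The operator `∑_{n ≥ 1} (z ^ n + z ^ (-n)) ∂/∂p_n`, with `∂/∂p_n` acting coefficientwise. The
sum is finite on Laurent series whose coefficients involve only finitely many of the `p_n`. -/
noncomputable def derivOp (g : LaurentSeries Lam) : LaurentSeries Lam :=
  ∑ᶠ n : ℕ+, (HahnSeries.single (n : ℤ) (1 : Lam) + HahnSeries.single (-(n : ℤ)) (1 : Lam)) *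
    g.map (pderiv n)

/-- The operator `exp (s * ∑_{n ≥ 1} (z ^ n + z ^ (-n)) ∂/∂p_n)` from `Λ` to `Λ((z))`. Each term
of the exponential series lowers the degree in the `p_n`, so that the series is finite on every
element of `Λ`. -/
noncomputable def expDeriv (s : ℚ) (f : Lam) : LaurentSeries Lam :=
  ∑ᶠ j : ℕ, (s ^ j / (j.factorial : ℚ)) • derivOp^[j] (HahnSeries.C f)

/-- The vertex operator
`Y(z) = exp (∑ (p_n / n) z ^ n) exp (-∑ (z ^ n + z ^ (-n)) ∂/∂p_n)`. -/
noncomputable def vertexY (f : Lam) : LaurentSeries Lam := expMul 1 * expDeriv (-1) f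

/-- The vertex operator
`Y*(z) = (1 - z ^ 2) exp (-∑ (p_n / n) z ^ n) exp (∑ (z ^ n + z ^ (-n)) ∂/∂p_n)`. -/
noncomputable def vertexYstar (f : Lam) : LaurentSeries Lam :=
  (1 - HahnSeries.single (2 : ℤ) (1 : Lam)) * (expMul (-1) * expDeriv 1 f)

/-- The component `Y_n`, where `Y(z) = ∑_n Y_n z ^ (-n)`. -/
noncomputable def Y (n : ℤ) (f : Lam) : Lam := (vertexY f).coeff (-n)

/-- The component `Y*_n`, where `Y*(z) = ∑_n Y*_n z ^ n`. -/
noncomputable def Ystar (n : ℤ) (f : Lam) : Lam := (vertexYstar f).coeff n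

/-- The product `A_{n 0} A_{n 1} ⋯ A_{n (k - 1)}` of components of a vertex operator, applied
to `f`. -/
def applyProd (A : ℤ → Lam → Lam) : (k : ℕ) → (n : ℕ → ℤ) → Lam → Lam
  | 0, _, f => f
  | k + 1, n, f => A (n 0) (applyProd A k (fun i => n (i + 1)) f)

/-- The symplectic Schur function `sp_μ = (1/2) det (h_{μ_i - i + j} + h_{μ_i - i - j + 2})`, a
determinant of size the number of parts of `μ` (the empty partition is written as `(0)`). The
indices `i`, `j` of the code start from `0`. -/
noncomputable def sp (μ : YoungDiagram) : Lam :=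
  (1 / 2 : ℚ) • (Matrix.of fun i j : Fin (max 1 (μ.colLen 0)) =>
    h ((μ.rowLen i : ℤ) - ((i : ℤ) + 1) + ((j : ℤ) + 1)) +
      h ((μ.rowLen i : ℤ) - ((i : ℤ) + 1) - ((j : ℤ) + 1) + 2)).det

/-- The length of the main diagonal of `μ`. -/
def diagLen (μ : YoungDiagram) : ℕ := (μ.cells.filter fun c => c.1 = c.2).card

/-- `α_{i+1} = μ_{i+1} - (i + 1)` in the Frobenius notation `μ = (α | β)`, for
`0 ≤ i < diagLen μ` (where the subtraction does not truncate). -/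
def frobA (μ : YoungDiagram) (i : ℕ) : ℕ := μ.rowLen i - (i + 1)

/-- `β_{i+1} = μ'_{i+1} - (i + 1)` in the Frobenius notation `μ = (α | β)`, for
`0 ≤ i < diagLen μ` (where the subtraction does not truncate). -/
def frobB (μ : YoungDiagram) (i : ℕ) : ℕ := μ.colLen i - (i + 1)

end SymFun

/-! The exponential of `s * ∑ (z^n + z^(-n)) ∂/∂p_n` is Taylor's shift `p_n ↦ p_n + s (z^n +
z^(-n))`, a ring homomorphism `Λ → Λ((z))` (`expDeriv_eq_shiftHom`). It multiplies `exp (t ∑ p_n u^n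
/ n)` by `((1 - z u)(1 - z⁻¹ u))^(-ts)`. Write `c_n = (-1)^n e_n` and `H(z) = ∑ h_n z^n`.

For `ts = -1` the factor is a quadratic polynomial in `u`, so the shift acts on the `h_n` (for `Y`)
and the `c_n` (for `Y*`) by a three-term rule. On determinants this rule is a unimodular column
operation. The same operation clears all but the first entry of a suitable row of Laurent
polynomials times `H(z)` or `H(z)⁻¹`, so applying one more vertex operator borders the determinant
by one row (`coeff_mul_shift_det`). By induction, products of `Y*` on `1` are determinants in the
`e_n` (`applyProd_Ystar`), and products of `Y` on `1` are the symplectic determinants in the `h_n`,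
the factor 1/2 halving the first column (`applyProd_Y`).

The two families are linked by `Y_m Y*_n + Y*_{n+1} Y_{m+1} = δ_{mn}` (`Y_Ystar_add_Ystar_Y`), which
is `H(z)⁻¹ H(z) = 1` on the vector `1` and propagates to `Λ` through multiplication by the `p_k`.
Pushing `Y*_c` through `c` factors `Y` attaches a column of length `c` to the diagram, with sign
`(-1)^c`. Building a diagram column by column turns the `Y` product over its rows into the `Y*`
product over its columns (`applyProd_Y_eq_applyProd_Ystar`). For the whole diagram this is the dual
determinant formula; for only the part below, or to the right of, the Durfee square it gives the
Frobenius formulas. -/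

namespace SymFun

/-! ### The exponential of the derivation as a shift of the power sums -/

/-- The Laurent polynomial `z ^ n + z ^ (-n)`. -/
noncomputable def zsum (n : ℤ) : LaurentSeries Lam :=
  HahnSeries.single n (1 : Lam) + HahnSeries.single (-n) (1 : Lam)

theorem rat_smul_eq (c : ℚ) (g : LaurentSeries Lam) :
    c • g = HahnSeries.C (algebraMap ℚ Lam c) * g := by
  ext1; ext1 a
  rw [HahnSeries.C_apply, HahnSeries.coeff_single_zero_mul, HahnSeries.coeff_smul,
    Algebra.smul_def]

/-- The substitution `p_n ↦ p_n + s (z ^ n + z ^ (-n))`. -/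
noncomputable def shiftHom (s : ℚ) : Lam →+* LaurentSeries Lam :=
  (MvPolynomial.eval₂Hom (HahnSeries.C.comp (algebraMap ℚ Lam)) fun n : ℕ+ =>
    (HahnSeries.C (p n) + s • zsum (n : ℤ) : LaurentSeries Lam)).comp
    (powerSumEquiv.symm : Lam ≃+* MvPolynomial ℕ+ ℚ).toRingHom

theorem powerSumEquiv_symm_p (n : ℕ+) : powerSumEquiv.symm (p n) = MvPolynomial.X n := by
  rw [← powerSumEquiv_X, AlgEquiv.symm_apply_apply]

theorem shiftHom_p (s : ℚ) (n : ℕ+) :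
    shiftHom s (p n) = HahnSeries.C (p n) + s • zsum (n : ℤ) := by
  simp [shiftHom, powerSumEquiv_symm_p]

theorem shiftHom_algebraMap (s c : ℚ) :
    shiftHom s (algebraMap ℚ Lam c) = HahnSeries.C (algebraMap ℚ Lam c) := by
  have : powerSumEquiv.symm (algebraMap ℚ Lam c) = MvPolynomial.C c :=
    powerSumEquiv.symm.commutes c
  simp only [shiftHom, RingHom.comp_apply]
  exact (congrArg _ this).trans (MvPolynomial.eval₂Hom_C _ _ _)

theorem induction_p {motive : Lam → Prop} (f : Lam)
    (const : ∀ c : ℚ, motive (algebraMap ℚ Lam c))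
    (add : ∀ f g, motive f → motive g → motive (f + g))
    (mul_p : ∀ (n : ℕ+) f, motive f → motive (p n * f)) : motive f := by
  obtain ⟨P, rfl⟩ := powerSumEquiv.surjective f
  induction P using MvPolynomial.induction_on with
  | C a =>
    have := const a
    rwa [← powerSumEquiv.commutes] at this
  | add P Q hP hQ => rw [map_add]; exact add _ _ hP hQ
  | mul_X P n hP => rw [mul_comm, map_mul, powerSumEquiv_X]; exact mul_p n _ hP

theorem pderiv_algebraMap (n : ℕ+) (c : ℚ) : pderiv n (algebraMap ℚ Lam c) = 0 := by
  simp [pderiv]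

theorem pderiv_p_mul (n k : ℕ+) (f : Lam) :
    pderiv n (p k * f) = p k * pderiv n f + if n = k then f else 0 := by
  classical
  simp only [pderiv, LinearMap.comp_apply, AlgEquiv.toLinearMap_apply, map_mul,
    powerSumEquiv_symm_p]
  change powerSumEquiv (MvPolynomial.pderiv n _) = _ * powerSumEquiv (MvPolynomial.pderiv n _) + _
  rw [Derivation.leibniz, MvPolynomial.pderiv_X, map_add, smul_eq_mul, smul_eq_mul, map_mul,
    powerSumEquiv_X, Pi.single_apply, map_mul]
  by_cases h : n = k
  · subst h; simp
  · simp [h, Ne.symm h]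

theorem map_pderiv_add (n : ℕ+) (g g' : LaurentSeries Lam) :
    (g + g').map (pderiv n) = g.map (pderiv n) + g'.map (pderiv n) := by
  ext a; simp

theorem map_pderiv_nsmul (n : ℕ+) (j : ℕ) (g : LaurentSeries Lam) :
    (j • g).map (pderiv n) = j • g.map (pderiv n) := by
  ext1; ext1 a
  rw [HahnSeries.map_coeff, HahnSeries.coeff_smul, HahnSeries.coeff_smul, map_nsmul,
    HahnSeries.map_coeff]

theorem map_pderiv_p_mul (n k : ℕ+) (g : LaurentSeries Lam) :
    (HahnSeries.C (p k) * g).map (pderiv n) =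
      HahnSeries.C (p k) * g.map (pderiv n) + if n = k then g else 0 := by
  ext a
  rw [HahnSeries.map_coeff, HahnSeries.C_apply, HahnSeries.coeff_single_zero_mul, pderiv_p_mul,
    HahnSeries.coeff_add, HahnSeries.coeff_single_zero_mul, HahnSeries.map_coeff]
  split_ifs <;> simp

theorem map_pderiv_zsum_mul (n : ℕ+) (k : ℤ) (g : LaurentSeries Lam) :
    (zsum k * g).map (pderiv n) = zsum k * g.map (pderiv n) := by
  ext a
  simp [zsum, add_mul, HahnSeries.coeff_single_mul]

/-- Only finitely many of the `p_n` occur in the coefficients. -/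
def FinitelyMany (g : LaurentSeries Lam) : Prop :=
  {n : ℕ+ | g.map (pderiv n) ≠ 0}.Finite

/-- A `finsum` with infinite support is zero by default, so `derivOp` is known to be additive only
where finiteness is known; hence the closure properties that follow. -/
theorem FinitelyMany.finite_support {g : LaurentSeries Lam} (hg : FinitelyMany g) :
    (Function.support fun n : ℕ+ => zsum (n : ℤ) * g.map (pderiv n)).Finite :=
  hg.subset fun n hn h => hn (by simp [h])

theorem FinitelyMany.add {g g' : LaurentSeries Lam} (hg : FinitelyMany g)
    (hg' : FinitelyMany g') : FinitelyMany (g + g') := by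
  refine (Set.Finite.union hg hg').subset fun n hn => ?_
  by_contra h
  simp only [Set.mem_union, Set.mem_ofPred_eq, not_or, not_not] at h
  exact hn (by rw [map_pderiv_add, h.1, h.2, add_zero])

theorem FinitelyMany.nsmul {g : LaurentSeries Lam} (hg : FinitelyMany g) (j : ℕ) :
    FinitelyMany (j • g) :=
  hg.subset fun n hn h => hn (by rw [map_pderiv_nsmul, h, nsmul_zero])

theorem FinitelyMany.p_mul {g : LaurentSeries Lam} (hg : FinitelyMany g) (k : ℕ+) :
    FinitelyMany (HahnSeries.C (p k) * g) := by
  refine (Set.Finite.union hg (Set.finite_singleton k)).subset fun n hn => ?_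
  by_contra h
  simp only [Set.mem_union, Set.mem_ofPred_eq, Set.mem_singleton_iff, not_or, not_not] at h
  exact hn (by rw [map_pderiv_p_mul, h.1, if_neg h.2, mul_zero, add_zero])

theorem FinitelyMany.zsum_mul {g : LaurentSeries Lam} (hg : FinitelyMany g) (k : ℤ) :
    FinitelyMany (zsum k * g) :=
  hg.subset fun n hn h => hn (by rw [map_pderiv_zsum_mul, h, mul_zero])

theorem derivOp_eq (g : LaurentSeries Lam) :
    derivOp g = ∑ᶠ n : ℕ+, zsum (n : ℤ) * g.map (pderiv n) := rfl

theorem derivOp_zero : derivOp 0 = 0 := by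
  rw [derivOp_eq]
  convert finsum_zero with n
  have : (0 : LaurentSeries Lam).map (pderiv n) = 0 := by ext a; simp
  rw [this, mul_zero]

theorem derivOp_add {g g' : LaurentSeries Lam} (hg : FinitelyMany g) (hg' : FinitelyMany g') :
    derivOp (g + g') = derivOp g + derivOp g' := by
  simp only [derivOp_eq, map_pderiv_add, mul_add]
  exact finsum_add_distrib hg.finite_support hg'.finite_support

theorem derivOp_nsmul {g : LaurentSeries Lam} (hg : FinitelyMany g) (j : ℕ) :
    derivOp (j • g) = j • derivOp g := by
  simp only [derivOp_eq, map_pderiv_nsmul, mul_smul_comm]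
  exact (smul_finsum' j hg.finite_support).symm

theorem derivOp_zsum_mul {g : LaurentSeries Lam} (hg : FinitelyMany g) (k : ℤ) :
    derivOp (zsum k * g) = zsum k * derivOp g := by
  simp only [derivOp_eq, map_pderiv_zsum_mul]
  rw [mul_finsum' _ _ hg.finite_support]
  exact finsum_congr fun n => by ring

/-- Leibniz rule: only the summand `n = k` differentiates `p k`. -/
theorem derivOp_p_mul {g : LaurentSeries Lam} (hg : FinitelyMany g) (k : ℕ+) :
    derivOp (HahnSeries.C (p k) * g) = HahnSeries.C (p k) * derivOp g + zsum (k : ℤ) * g := by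
  simp only [derivOp_eq, map_pderiv_p_mul, mul_add]
  rw [finsum_add_distrib, mul_finsum' _ _ hg.finite_support,
    finsum_eq_single (fun n : ℕ+ => zsum (n : ℤ) * if n = k then g else 0) k
      (fun n hn => by simp [hn]), if_pos rfl]
  · congr 1
    exact finsum_congr fun n => by ring
  · refine hg.finite_support.subset fun n hn h => hn ?_
    simp only at h ⊢
    rw [mul_left_comm, h, mul_zero]
  · refine (Set.finite_singleton k).subset fun n hn => ?_
    by_contra h
    exact hn (by simp only [Set.mem_singleton_iff] at h; simp [h])

/-- The derivation sends `p k` to a Laurent polynomial with constant coefficients, which it then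
treats as a scalar, so the higher Leibniz formula has only two terms. The truncated `j - 1` at `j =
0` is harmless, its coefficient being zero. -/
theorem iterate_derivOp_p_mul {g : LaurentSeries Lam}
    (hg : ∀ j, FinitelyMany (derivOp^[j] g)) (k : ℕ+) (j : ℕ) :
    derivOp^[j] (HahnSeries.C (p k) * g) = HahnSeries.C (p k) * derivOp^[j] g +
      j • (zsum (k : ℤ) * derivOp^[j - 1] g) := by
  induction j with
  | zero => simp
  | succ j ih =>
    rw [Function.iterate_succ_apply', ih,
      derivOp_add ((hg j).p_mul k) (((hg _).zsum_mul _).nsmul j), derivOp_p_mul (hg j),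
      derivOp_nsmul ((hg _).zsum_mul _), derivOp_zsum_mul (hg _),
      Function.iterate_succ_apply', add_assoc]
    congr 1
    rcases j with _ | j
    · simp
    · simp only [Nat.add_sub_cancel, ← Function.iterate_succ_apply' derivOp]
      rw [succ_nsmul _ (j + 1), add_comm]

theorem iterate_derivOp_add {g g' : LaurentSeries Lam} (hg : ∀ j, FinitelyMany (derivOp^[j] g))
    (hg' : ∀ j, FinitelyMany (derivOp^[j] g')) (j : ℕ) :
    derivOp^[j] (g + g') = derivOp^[j] g + derivOp^[j] g' := by
  induction j with
  | zero => simp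
  | succ j ih => simp only [Function.iterate_succ_apply', ih, derivOp_add (hg j) (hg' j)]

theorem expDeriv_eq_sum (s : ℚ) {f : Lam} {J : ℕ}
    (hJ : ∀ j, J ≤ j → derivOp^[j] (HahnSeries.C f) = 0) :
    expDeriv s f =
      ∑ j ∈ Finset.range J, (s ^ j / (j.factorial : ℚ)) • derivOp^[j] (HahnSeries.C f) := by
  refine finsum_eq_sum_of_support_subset _ fun j hj => ?_
  by_contra h
  rw [Finset.coe_range, Set.mem_Iio, not_lt] at h
  exact hj (by simp only [hJ j h, smul_zero])

theorem expDeriv_eq_shiftHom (s : ℚ) (f : Lam) : expDeriv s f = shiftHom s f := by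
  -- The induction must also carry the finiteness of both sums, in `n` and in `j`. Multiplying by `p
  -- k`, the second Leibniz term reindexes to `s (z^k + z^(-k))` times the same exponential, which
  -- is the rule defining the shift.
  suffices H : (∀ j, FinitelyMany (derivOp^[j] (HahnSeries.C f))) ∧
      (∃ J, ∀ j, J ≤ j → derivOp^[j] (HahnSeries.C f) = 0) ∧ expDeriv s f = shiftHom s f from
    H.2.2
  induction f using induction_p with
  | const c =>
    have hmap (n : ℕ+) : (HahnSeries.C (algebraMap ℚ Lam c)).map (pderiv n) =
        (0 : LaurentSeries Lam) := by
      ext a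
      simp only [HahnSeries.map_coeff, HahnSeries.C_apply, HahnSeries.coeff_single]
      split_ifs
      · rw [pderiv_algebraMap]; rfl
      · rw [map_zero]; rfl
    have h1 : derivOp (HahnSeries.C (algebraMap ℚ Lam c)) = 0 := by
      rw [derivOp_eq]
      simp only [hmap, mul_zero, finsum_zero]
    have hz (j : ℕ) : derivOp^[j + 1] (HahnSeries.C (algebraMap ℚ Lam c)) = 0 := by
      induction j with
      | zero => simpa using h1
      | succ j ih => rw [Function.iterate_succ_apply', ih, derivOp_zero]
    have hz' (j : ℕ) (hj : 1 ≤ j) : derivOp^[j] (HahnSeries.C (algebraMap ℚ Lam c)) = 0 := by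
      obtain ⟨j, rfl⟩ := Nat.exists_eq_add_of_le' hj
      exact hz j
    refine ⟨fun j => ?_, ⟨1, hz'⟩, ?_⟩
    · rcases j with _ | j
      · simp only [FinitelyMany, Function.iterate_zero, id, hmap, ne_eq, not_true_eq_false]
        simp
      · rw [hz]
        have (n : ℕ+) : (0 : LaurentSeries Lam).map (pderiv n) = 0 := by ext a; simp
        simp [FinitelyMany, this]
    · rw [expDeriv_eq_sum s hz', shiftHom_algebraMap]
      simp
  | add f g hf hg =>
    obtain ⟨hf1, ⟨J, hJ⟩, hf2⟩ := hf
    obtain ⟨hg1, ⟨K, hK⟩, hg2⟩ := hg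
    have hadd (j : ℕ) := iterate_derivOp_add hf1 hg1 j
    have hz (j : ℕ) (hj : max J K ≤ j) : derivOp^[j] (HahnSeries.C (f + g)) = 0 := by
      rw [map_add, hadd, hJ j (by omega), hK j (by omega), add_zero]
    refine ⟨fun j => ?_, ⟨_, hz⟩, ?_⟩
    · rw [map_add, hadd]; exact (hf1 j).add (hg1 j)
    · rw [expDeriv_eq_sum s hz, map_add, map_add, ← hf2, ← hg2,
        expDeriv_eq_sum s (J := max J K) (fun j hj => hJ j (by omega)),
        expDeriv_eq_sum s (J := max J K) (fun j hj => hK j (by omega)), ← Finset.sum_add_distrib]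
      exact Finset.sum_congr rfl fun j _ => by rw [hadd, smul_add]
  | mul_p k f hf =>
    obtain ⟨hf1, ⟨J, hJ⟩, hf2⟩ := hf
    have hmul (j : ℕ) := iterate_derivOp_p_mul hf1 k j
    have hz (j : ℕ) (hj : J + 1 ≤ j) : derivOp^[j] (HahnSeries.C (p k * f)) = 0 := by
      rw [map_mul, hmul, hJ j (by omega), hJ (j - 1) (by omega)]; simp
    refine ⟨fun j => ?_, ⟨_, hz⟩, ?_⟩
    · rw [map_mul, hmul]; exact ((hf1 j).p_mul k).add (((hf1 _).zsum_mul _).nsmul j)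
    · rw [expDeriv_eq_sum s hz, map_mul, map_mul, shiftHom_p, ← hf2, add_mul]
      simp only [hmul, smul_add, Finset.sum_add_distrib]
      congr 1
      · rw [expDeriv_eq_sum s (J := J + 1) (fun j hj => hJ j (by omega)), Finset.mul_sum]
        exact Finset.sum_congr rfl fun j _ => by
          rw [rat_smul_eq, rat_smul_eq, mul_left_comm]
      · rw [Finset.sum_range_succ', expDeriv_eq_sum s hJ, Finset.mul_sum]
        simp only [zero_nsmul, smul_zero, add_zero, Nat.add_sub_cancel]
        refine Finset.sum_congr rfl fun j _ => ?_
        have hc : s ^ (j + 1) / ((j + 1).factorial : ℚ) * ((j + 1 : ℕ) : ℚ) =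
            s * (s ^ j / (j.factorial : ℚ)) := by
          have := Nat.factorial_ne_zero j
          rw [Nat.factorial_succ]
          push_cast
          field_simp
          ring
        rw [nsmul_eq_mul, rat_smul_eq, rat_smul_eq, rat_smul_eq,
          ← map_natCast (HahnSeries.C.comp (algebraMap ℚ Lam) : ℚ →+* LaurentSeries Lam),
          RingHom.comp_apply, ← mul_assoc, ← map_mul, ← map_mul, hc, map_mul, map_mul]
        ring

/-! ### Monomial coefficients and the identities relating `p`, `h` and `e` -/

theorem coeff_ofMonomials (P : (ℕ →₀ ℕ) → Prop) [DecidablePred P] (hP hd) (m : ℕ →₀ ℕ) :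
    MvPowerSeries.coeff m (ofMonomials P hP hd : MvPowerSeries ℕ ℚ) = if P m then 1 else 0 := by
  change @ite ℚ (P m) (Classical.propDecidable _) 1 0 = _
  congr

theorem coeff_h (n : ℤ) (m : ℕ →₀ ℕ) :
    MvPowerSeries.coeff m (h n : MvPowerSeries ℕ ℚ) = if (m.degree : ℤ) = n then 1 else 0 :=
  coeff_ofMonomials _ _ _ _

open Classical in
theorem coeff_e (n : ℤ) (m : ℕ →₀ ℕ) :
    MvPowerSeries.coeff m (e n : MvPowerSeries ℕ ℚ) =
      if (m.degree : ℤ) = n ∧ ∀ i, m i ≤ 1 then 1 else 0 :=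
  coeff_ofMonomials _ _ _ _

open Classical in
theorem coeff_p (n : ℕ) (m : ℕ →₀ ℕ) :
    MvPowerSeries.coeff m (p n : MvPowerSeries ℕ ℚ) =
      if ∃ i, m = Finsupp.single i n then 1 else 0 :=
  coeff_ofMonomials _ _ _ _

theorem h_of_neg {n : ℤ} (hn : n < 0) : h n = 0 := by
  apply Subtype.ext
  ext m
  rw [coeff_h, if_neg (by omega)]
  simp

theorem e_of_neg {n : ℤ} (hn : n < 0) : e n = 0 := by
  apply Subtype.ext
  ext m
  rw [coeff_e, if_neg (by omega)]
  simp

theorem h_zero : h 0 = 1 := by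
  classical
  apply Subtype.ext
  ext m
  rw [coeff_h, Subalgebra.coe_one, MvPowerSeries.coeff_one]
  simp [Finsupp.degree_eq_zero_iff]

theorem e_zero : e 0 = 1 := by
  classical
  apply Subtype.ext
  ext m
  rw [coeff_e, Subalgebra.coe_one, MvPowerSeries.coeff_one]
  refine if_congr ⟨fun hm => by simpa [Finsupp.degree_eq_zero_iff] using hm.1, ?_⟩ rfl rfl
  rintro rfl
  simp

-- Newton's identity: the coefficient of a monomial `m` counts the powers `x_a^(i+1)` dividing it,
-- that is, pairs `(a, i)` with `i < m a`, and there are `m.degree` of them.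
open Finset.HasAntidiagonal in
theorem sum_p_mul_h (n : ℕ) :
    ∑ x ∈ antidiagonal n, p (x.1 + 1) * h x.2 = ((n : ℚ) + 1) • h ((n : ℤ) + 1) := by
  classical
  apply Subtype.ext
  ext m
  rw [AddSubmonoidClass.coe_finsetSum, map_sum, Subalgebra.coe_smul, MvPowerSeries.coeff_smul,
    coeff_h]
  simp only [Subalgebra.coe_mul, MvPowerSeries.coeff_mul, coeff_p, coeff_h, Nat.cast_inj,
    ← ite_and, mul_ite, mul_one, mul_zero]
  rw [← Finset.sum_product', Finset.sum_boole]
  by_cases hm : m.degree = n + 1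
  · rw [if_pos (by omega)]
    have hs : (m.support.sigma fun a => Finset.range (m a)).card = n + 1 := by
      rw [Finset.card_sigma, ← hm, Finsupp.degree_apply]
      simp
    rw [← Nat.cast_succ, Nat.cast_inj, Nat.succ_eq_add_one, ← hs]
    symm
    refine Finset.card_bij (fun a _ => ((a.2, n - a.2), (Finsupp.single a.1 (a.2 + 1),
      m - Finsupp.single a.1 (a.2 + 1)))) ?_ ?_ ?_
    · rintro ⟨a, i⟩ ha
      simp only [Finset.mem_sigma, Finset.mem_range, Finsupp.mem_support_iff] at ha
      have hle : Finsupp.single a (i + 1) ≤ m := by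
        rw [Finsupp.single_le_iff]; omega
      have hma : m a ≤ m.degree := Finsupp.le_degree a m
      have hadd : Finsupp.single a (i + 1) + (m - Finsupp.single a (i + 1)) = m :=
        add_tsub_cancel_of_le hle
      have hdeg := congrArg Finsupp.degree hadd
      rw [map_add, Finsupp.degree_single] at hdeg
      simp only [Finset.mem_filter, Finset.mem_product, mem_antidiagonal]
      exact ⟨⟨by omega, hadd⟩, by omega, a, rfl⟩
    · rintro ⟨a, i⟩ _ ⟨b, j⟩ _ hab
      simp only [Prod.mk.injEq] at hab
      obtain ⟨⟨rfl, -⟩, hab, -⟩ := hab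
      rw [(Finsupp.single_left_inj (by omega)).mp hab]
    · rintro ⟨⟨i, j⟩, ⟨x, y⟩⟩ hx
      simp only [Finset.mem_filter, Finset.mem_product, mem_antidiagonal] at hx
      obtain ⟨⟨rfl, rfl⟩, hy, a, rfl⟩ := hx
      refine ⟨⟨a, i⟩, ?_, ?_⟩
      · simp
        omega
      · simp
  · rw [if_neg (by omega), Nat.cast_eq_zero, Finset.card_eq_zero,
      Finset.filter_eq_empty_iff]
    rintro ⟨⟨i, j⟩, ⟨x, y⟩⟩ hx ⟨h1, a, h2⟩
    simp only [Finset.mem_product, mem_antidiagonal] at hx h1 h2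
    obtain ⟨rfl, rfl⟩ := hx
    apply hm
    rw [map_add, h2, Finsupp.degree_single, h1]
    ring

-- The coefficient of `m` is the signed count of its squarefree divisors. These are the subsets of
-- its support, which is nonempty in degree `n ≠ 0`, so they cancel.
open Finset.HasAntidiagonal in
theorem sum_e_mul_h (n : ℕ) (hn : n ≠ 0) :
    ∑ x ∈ antidiagonal n, ((-1 : ℚ) ^ x.1 • e x.1) * h x.2 = 0 := by
  classical
  apply Subtype.ext
  ext m
  rw [AddSubmonoidClass.coe_finsetSum, map_sum]
  simp only [Subalgebra.coe_mul, Subalgebra.coe_smul, MvPowerSeries.coeff_mul,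
    MvPowerSeries.coeff_smul, coeff_e, coeff_h, Nat.cast_inj]
  rw [Finset.sum_comm]
  have inner (x : (ℕ →₀ ℕ) × (ℕ →₀ ℕ)) (hx : x ∈ antidiagonal m) :
      ∑ y ∈ antidiagonal n, ((-1 : ℚ) ^ y.1 * if x.1.degree = y.1 ∧ ∀ i, x.1 i ≤ 1 then (1 : ℚ)
        else 0) * (if x.2.degree = y.2 then 1 else 0) =
      if m.degree = n ∧ ∀ i, x.1 i ≤ 1 then (-1 : ℚ) ^ x.1.degree else 0 := by
    rw [mem_antidiagonal] at hx
    subst hx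
    rw [map_add]
    split_ifs with hc
    · rw [Finset.sum_eq_single (x.1.degree, x.2.degree)]
      · simp [hc.2]
      · rintro ⟨a, b⟩ _ hab
        rw [Ne, Prod.mk.injEq, not_and_or] at hab
        rcases hab with hab | hab
        · simp [Ne.symm hab]
        · simp [Ne.symm hab]
      · intro hc'
        exact absurd (mem_antidiagonal.mpr hc.1) hc'
    · refine Finset.sum_eq_zero ?_
      rintro ⟨a, b⟩ hab
      rw [mem_antidiagonal] at hab
      simp only at hab ⊢
      split_ifs with h1 h2
      · exact absurd ⟨by omega, h1.2⟩ hc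
      all_goals simp
  rw [Finset.sum_congr rfl inner]
  by_cases hm : m.degree = n
  · simp only [hm, true_and]
    rw [← Finset.sum_filter]
    have hne : m.support.Nonempty := by
      rw [Finset.nonempty_iff_ne_empty, Ne, Finsupp.support_eq_empty]
      rintro rfl
      exact hn (by rw [← hm]; simp)
    have hz : ∑ S ∈ m.support.powerset, (-1 : ℚ) ^ S.card = 0 := by
      have := Finset.sum_powerset_neg_one_pow_card_of_nonempty hne
      exact_mod_cast congrArg (Int.cast : ℤ → ℚ) this
    simp only [Subalgebra.coe_zero, map_zero]
    rw [← hz]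
    symm
    refine Finset.sum_bij (fun S _ => (Finsupp.indicator S fun _ _ => 1,
      m - Finsupp.indicator S fun _ _ => 1)) ?_ ?_ ?_ ?_
    · intro S hS
      rw [Finset.mem_powerset] at hS
      rw [Finset.mem_filter, mem_antidiagonal]
      refine ⟨add_tsub_cancel_of_le fun i => ?_, fun i => ?_⟩
      · rw [Finsupp.indicator_apply]
        split_ifs with hi
        · have := hS hi
          rw [Finsupp.mem_support_iff] at this
          omega
        · omega
      · simp only [Finsupp.indicator_apply]
        split_ifs <;> omega
    · intro S _ T _ hST
      rw [Prod.mk.injEq] at hST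
      ext i
      have := DFunLike.congr_fun hST.1 i
      simp only [Finsupp.indicator_apply] at this
      by_cases h1 : i ∈ S <;> by_cases h2 : i ∈ T <;> simp_all
    · rintro ⟨x, y⟩ hx
      simp only [Finset.mem_filter, mem_antidiagonal] at hx
      obtain ⟨rfl, hx⟩ := hx
      have hxi : (Finsupp.indicator x.support fun _ _ => 1) = x := by
        ext i
        have := hx i
        rw [Finsupp.indicator_apply]
        split_ifs with hi
        · rw [Finsupp.mem_support_iff] at hi; omega
        · rw [Finsupp.mem_support_iff, not_not] at hi; exact hi.symm
      refine ⟨x.support, ?_, ?_⟩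
      · rw [Finset.mem_powerset]
        intro i hi
        rw [Finsupp.mem_support_iff] at hi ⊢
        rw [Finsupp.add_apply]; omega
      · rw [hxi]; simp
    · intro S _
      congr 1
      rw [Finsupp.degree_apply, Finset.card_eq_sum_ones]
      have hsub : (Finsupp.indicator S fun _ _ => 1 : ℕ →₀ ℕ).support ⊆ S :=
        Finsupp.support_indicator_subset S _
      have hone (i : ℕ) (hi : i ∈ S) : (Finsupp.indicator S fun _ _ => 1 : ℕ →₀ ℕ) i = 1 := by
        rw [Finsupp.indicator_apply, dif_pos hi]
      have hsupp : (Finsupp.indicator S fun _ _ => 1 : ℕ →₀ ℕ).support = S :=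
        hsub.antisymm fun i hi => by rw [Finsupp.mem_support_iff, hone i hi]; exact one_ne_zero
      rw [hsupp]
      exact (Finset.sum_congr rfl hone).symm
  · simp [hm]

/-! ### The exponential series as generating functions of `h` and `e` -/

instance : IsAddTorsionFree Lam := IsAddTorsionFree.of_module_rat Lam

instance : IsAddTorsionFree (LaurentSeries Lam) where
  nsmul_right_injective n hn x y hxy := by
    ext1; ext1 a
    have := congrArg (fun g : LaurentSeries Lam => g.coeff a) hxy
    simp only [HahnSeries.coeff_smul] at this
    exact nsmul_right_injective hn this

-- The equation determines `n + 1` times the coefficient of degree `n + 1` from the lower ones, and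
-- torsion-freeness allows the division. This uniqueness replaces computations with logarithms.
open PowerSeries in
theorem eq_of_derivative_eq_mul {K : Type*} [CommRing K] [IsAddTorsionFree K] {F G Q : K⟦X⟧}
    (hF : d⁄dX K F = Q * F) (hG : d⁄dX K G = Q * G)
    (h0 : constantCoeff F = constantCoeff G) : F = G := by
  ext n
  induction n using Nat.strong_induction_on with
  | _ n ih =>
    rcases n with _ | n
    · simpa using h0
    have h1 := congrArg (coeff n) hF
    have h2 := congrArg (coeff n) hG
    rw [coeff_derivative, coeff_mul] at h1 h2
    have h3 : coeff (n + 1) F * (n + 1) = coeff (n + 1) G * (n + 1) := by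
      rw [h1, h2]
      refine Finset.sum_congr rfl fun x hx => ?_
      rw [ih x.2 (by rw [Finset.HasAntidiagonal.mem_antidiagonal] at hx; omega)]
    rw [← Nat.cast_succ, mul_comm, ← nsmul_eq_mul, mul_comm, ← nsmul_eq_mul] at h3
    exact (smul_right_inj (Nat.succ_ne_zero n)).mp h3

open PowerSeries in
theorem derivative_map {R S : Type*} [CommRing R] [CommRing S] (f : R →+* S) (F : R⟦X⟧) :
    d⁄dX S (map f F) = map f (d⁄dX R F) := by
  ext n
  simp [coeff_derivative]

/-- The series `exp (s * ∑_{n ≥ 1} (p_n / n) z ^ n)` in `Λ[[z]]`. -/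
noncomputable def expSeries (s : ℚ) : PowerSeries Lam :=
  (PowerSeries.exp ℚ).subst (PowerSeries.mk fun n : ℕ => (s / (n : ℚ)) • p n : PowerSeries Lam)

theorem expMul_eq (s : ℚ) : expMul s = HahnSeries.ofPowerSeries ℤ Lam (expSeries s) := rfl

/-- The convention `s / 0 = 0` removes the term `n = 0`, so the value of `p 0` plays no role and the
substitution is legitimate. -/
theorem constantCoeff_mk_p (s : ℚ) :
    PowerSeries.constantCoeff (PowerSeries.mk fun n : ℕ => (s / (n : ℚ)) • p n) = 0 := by
  rw [← PowerSeries.coeff_zero_eq_constantCoeff_apply, PowerSeries.coeff_mk]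
  simp

open PowerSeries in
theorem constantCoeff_expSeries (s : ℚ) : constantCoeff (expSeries s) = 1 := by
  have hs : HasSubst (mk fun n : ℕ => (s / (n : ℚ)) • p n) :=
    HasSubst.of_constantCoeff_zero' (constantCoeff_mk_p s)
  rw [← coeff_zero_eq_constantCoeff_apply, expSeries, coeff_subst' hs,
    finsum_eq_single _ 0]
  · simp
  · intro n hn
    rw [coeff_zero_eq_constantCoeff_apply, map_pow, constantCoeff_mk_p, zero_pow hn, smul_zero]

open PowerSeries in
theorem derivative_expSeries (s : ℚ) :
    d⁄dX Lam (expSeries s) = mk (fun n : ℕ => s • p (n + 1)) * expSeries s := by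
  have hs : HasSubst (mk fun n : ℕ => (s / (n : ℚ)) • p n) :=
    HasSubst.of_constantCoeff_zero' (constantCoeff_mk_p s)
  -- The exponential is moved to coefficients in `Λ` so that the chain rule applies over a single
  -- ring.
  have hexp : expSeries s = (exp Lam).subst (mk fun n : ℕ => (s / (n : ℚ)) • p n) := by
    ext1 n
    rw [expSeries, coeff_subst' hs, coeff_subst' hs]
    refine finsum_congr fun d => ?_
    rw [coeff_exp, coeff_exp, smul_eq_mul, ← Algebra.smul_def]
    rfl
  rw [hexp, derivative_subst hs, derivative_exp, mul_comm]
  congr 1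
  ext1 n
  rw [coeff_derivative, coeff_mk, coeff_mk, ← Nat.cast_succ, mul_comm, ← nsmul_eq_mul,
    ← Nat.cast_smul_eq_nsmul ℚ, smul_smul]
  congr 1
  have : ((n + 1 : ℕ) : ℚ) ≠ 0 := by positivity
  field_simp

/-- Newton's identity says that `∑ h_n z^n` solves the differential equation of the exponential. -/
theorem expSeries_one : expSeries 1 = PowerSeries.mk fun n : ℕ => h n := by
  refine eq_of_derivative_eq_mul (derivative_expSeries 1) ?_ ?_
  · ext1 n
    rw [PowerSeries.coeff_derivative, PowerSeries.coeff_mul, PowerSeries.coeff_mk]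
    simp only [PowerSeries.coeff_mk, one_smul]
    rw [sum_p_mul_h, ← Nat.cast_succ, ← Nat.cast_succ, ← Nat.cast_succ, mul_comm, ← nsmul_eq_mul,
      ← Nat.cast_smul_eq_nsmul ℚ]
  · rw [constantCoeff_expSeries, ← PowerSeries.coeff_zero_eq_constantCoeff_apply,
      PowerSeries.coeff_mk]
    exact h_zero.symm

theorem expSeries_mul_neg (s : ℚ) : expSeries s * expSeries (-s) = 1 := by
  apply PowerSeries.derivative.ext
  · rw [Derivation.leibniz, derivative_expSeries, derivative_expSeries, smul_eq_mul, smul_eq_mul,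
      Derivation.map_one_eq_zero]
    have : (PowerSeries.mk fun n : ℕ => (-s) • p (n + 1)) =
        -PowerSeries.mk fun n : ℕ => s • p (n + 1) := by
      ext1 n
      rw [map_neg, PowerSeries.coeff_mk, PowerSeries.coeff_mk, neg_smul]
    rw [this]
    ring
  · rw [map_mul, constantCoeff_expSeries, constantCoeff_expSeries, map_one, one_mul]

/-- Both sides are inverse to `∑ h_n z^n`. -/
theorem expSeries_neg_one :
    expSeries (-1) = PowerSeries.mk fun n : ℕ => (-1 : ℚ) ^ n • e n := by
  have h1 := expSeries_mul_neg 1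
  have h2 : (PowerSeries.mk fun n : ℕ => (-1 : ℚ) ^ n • e n) * expSeries 1 = 1 := by
    rw [expSeries_one]
    ext1 n
    rw [PowerSeries.coeff_mul, PowerSeries.coeff_one]
    simp only [PowerSeries.coeff_mk]
    split_ifs with hn
    · subst hn
      simp [e_zero, h_zero]
    · exact sum_e_mul_h n hn
  calc expSeries (-1) = _ * expSeries 1 * expSeries (-1) := by rw [h2, one_mul]
    _ = _ := by rw [mul_assoc, h1, mul_one]

/-- The coefficient of `z ^ n` in `exp (t * ∑_{n ≥ 1} (p_n / n) z ^ n)`. -/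
noncomputable def expCoeff (t : ℚ) (n : ℤ) : Lam := (expMul t).coeff n

theorem expCoeff_natCast (t : ℚ) (n : ℕ) :
    expCoeff t n = PowerSeries.coeff n (expSeries t) := by
  rw [expCoeff, expMul_eq, HahnSeries.ofPowerSeries_apply_coeff]

theorem expCoeff_of_neg (t : ℚ) {n : ℤ} (hn : n < 0) : expCoeff t n = 0 := by
  rw [expCoeff, expMul_eq, HahnSeries.ofPowerSeries_apply, HahnSeries.embDomain_of_notMem_range]
  rintro ⟨m, hm⟩
  simp at hm
  omega

theorem expCoeff_one (n : ℤ) : expCoeff 1 n = h n := by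
  rcases lt_or_ge n 0 with hn | hn
  · rw [expCoeff_of_neg _ hn, h_of_neg hn]
  · lift n to ℕ using hn
    rw [expCoeff_natCast, expSeries_one, PowerSeries.coeff_mk]

theorem expCoeff_neg_one (n : ℤ) : expCoeff (-1) n = (-1 : ℚ) ^ n • e n := by
  rcases lt_or_ge n 0 with hn | hn
  · rw [expCoeff_of_neg _ hn, e_of_neg hn, smul_zero]
  · lift n to ℕ using hn
    rw [expCoeff_natCast, expSeries_neg_one, PowerSeries.coeff_mk, zpow_natCast]

theorem expCoeff_zero (t : ℚ) : expCoeff t 0 = 1 := by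
  have := expCoeff_natCast t 0
  rwa [PowerSeries.coeff_zero_eq_constantCoeff_apply, constantCoeff_expSeries] at this

/-! ### The vertex operators written through the shift -/

/-- The ring `Λ((z))`. -/
def Laurent : Type := LaurentSeries Lam

noncomputable instance : CommRing Laurent := inferInstanceAs (CommRing (LaurentSeries Lam))

instance : IsAddTorsionFree Laurent := inferInstanceAs (IsAddTorsionFree (LaurentSeries Lam))

namespace Laurent

/-- The constant series. -/
noncomputable def const : Lam →+* Laurent := (HahnSeries.C : Lam →+* LaurentSeries Lam)

/-- The monomial `z ^ n`. -/
noncomputable def zpw (n : ℤ) : Laurent := (HahnSeries.single n (1 : Lam) : LaurentSeries Lam)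

/-- The coefficient of `z ^ n`. -/
noncomputable def coeff (n : ℤ) : Laurent →+ Lam where
  toFun g := HahnSeries.coeff (g : LaurentSeries Lam) n
  map_zero' := rfl
  map_add' _ _ := rfl

theorem zpw_mul_zpw (a b : ℤ) : zpw a * zpw b = zpw (a + b) := by
  refine (HahnSeries.single_mul_single (a := a) (b := b) (r := (1 : Lam)) (s := 1)).trans ?_
  rw [mul_one]
  rfl

theorem zpw_zero : zpw 0 = 1 := rfl

theorem coeff_const_mul (n : ℤ) (a : Lam) (g : Laurent) :
    coeff n (const a * g) = a * coeff n g :=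
  HahnSeries.coeff_single_zero_mul

theorem coeff_zpw_mul (n k : ℤ) (g : Laurent) : coeff n (zpw k * g) = coeff (n - k) g :=
  (HahnSeries.coeff_single_mul (r := (1 : Lam)) (x := g) (a := n) (b := k)).trans (one_mul _)

/-- The Laurent polynomial `z ^ n + z ^ (-n)`. -/
noncomputable def zpm (n : ℤ) : Laurent := zpw n + zpw (-n)

/-- The substitution `p_n ↦ p_n + s (z ^ n + z ^ (-n))`. -/
noncomputable def shift (s : ℚ) : Lam →+* Laurent := shiftHom s

theorem shift_algebraMap (s c : ℚ) : shift s (algebraMap ℚ Lam c) = const (algebraMap ℚ Lam c) :=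
  shiftHom_algebraMap s c

theorem shift_p (s : ℚ) (n : ℕ) :
    shift s (p (n + 1)) = const (p (n + 1)) + const (algebraMap ℚ Lam s) * zpm (n + 1) := by
  have h := shiftHom_p s n.succPNat
  rw [rat_smul_eq] at h
  exact h

/-- The series `exp (t * ∑_{n ≥ 1} (p_n / n) z ^ n)`. -/
noncomputable def expS (t : ℚ) : Laurent := expMul t

theorem coeff_expS (t : ℚ) (n : ℤ) : coeff n (expS t) = expCoeff t n := rfl

end Laurent

open Laurent

theorem Y_eq (n : ℤ) (f : Lam) : Y n f = coeff (-n) (expS 1 * shift (-1) f) := by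
  rw [Y, vertexY, expDeriv_eq_shiftHom]
  rfl

theorem Ystar_eq (n : ℤ) (f : Lam) :
    Ystar n f = coeff n ((1 - zpw 2) * expS (-1) * shift 1 f) := by
  rw [Ystar, vertexYstar, expDeriv_eq_shiftHom, ← mul_assoc]
  rfl

/-! ### The shift on generating series -/

section GeneratingSeries

open PowerSeries hiding coeff

/-- The polynomial `(1 - z t) (1 - z⁻¹ t)` in `t`. -/
noncomputable def shiftFactor : PowerSeries Laurent :=
  1 - C (zpm 1) * X + X ^ 2

theorem zpm_neg (n : ℤ) : zpm (-n) = zpm n := by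
  rw [zpm, zpm, neg_neg, add_comm]

theorem zpm_zero : zpm 0 = 2 := by
  rw [zpm, neg_zero, zpw_zero, one_add_one_eq_two]

theorem zpm_mul_zpm (a b : ℤ) : zpm a * zpm b = zpm (a + b) + zpm (a - b) := by
  simp only [zpm, mul_add, add_mul, zpw_mul_zpw]
  rw [show -a + b = -(a - b) by ring, show a + -b = a - b by ring,
    show -a + -b = -(a + b) by ring]
  ring

/-- This is the logarithmic derivative of `(1 - z t)(1 - z⁻¹ t)`, checked coefficientwise through
the product rule for the `zpm`. -/
theorem derivative_shiftFactor :
    d⁄dX Laurent shiftFactor =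
      -(mk fun n : ℕ => zpm ((n : ℤ) + 1)) * shiftFactor := by
  have h2 : d⁄dX Laurent (X ^ 2 : PowerSeries Laurent) = C 2 * X := by
    rw [derivative_pow, derivative_X, map_ofNat]
    simp
  ext1 n
  rw [shiftFactor, map_add, map_sub, Derivation.map_one_eq_zero, Derivation.leibniz, derivative_C,
    derivative_X, h2, smul_zero, add_zero, smul_eq_mul, mul_one, zero_sub, mul_add, mul_sub,
    mul_one, mul_left_comm]
  rcases n with _ | _ | n
  · simp
  · simp only [map_add, map_sub, map_neg, coeff_mul_X_pow', coeff_succ_mul_X, coeff_C_mul,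
      neg_mul, mul_neg, coeff_mk, coeff_C]
    rw [zpm_mul_zpm]
    norm_num [zpm_zero]
  · simp only [map_add, map_sub, map_neg, coeff_mul_X_pow', coeff_succ_mul_X, coeff_C_mul,
      neg_mul, mul_neg, coeff_mk, coeff_C]
    rw [zpm_mul_zpm, if_neg (by omega), if_neg (by omega), if_pos (by omega)]
    rw [show 1 + (((n + 1 : ℕ) : ℤ) + 1) = ((n + 1 + 1 : ℕ) : ℤ) + 1 by push_cast; ring,
      ← zpm_neg (1 - _),
      show -(1 - (((n + 1 : ℕ) : ℤ) + 1)) = ((n + 1 + 1 - 2 : ℕ) : ℤ) + 1 by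
        push_cast [show n + 1 + 1 - 2 = n by omega]; ring]
    ring

/-- Both sides have the same logarithmic derivative and constant term `1`. -/
theorem map_shift_expSeries {s t : ℚ} (hst : t * s = -1) :
    map (shift s) (expSeries t) = map const (expSeries t) * shiftFactor := by
  refine eq_of_derivative_eq_mul (Q := mk fun n : ℕ => const (t • p (n + 1)) -
    zpm ((n : ℤ) + 1)) ?_ ?_ ?_
  · rw [derivative_map, derivative_expSeries, map_mul]
    congr 1
    ext1 n
    rw [coeff_map, coeff_mk, coeff_mk, Algebra.smul_def, map_mul, map_mul, shift_algebraMap,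
      shift_p, mul_add, ← mul_assoc, ← map_mul const, ← map_mul const, ← map_mul (algebraMap ℚ Lam),
      hst]
    simp [sub_eq_add_neg]
  · rw [Derivation.leibniz, derivative_shiftFactor, derivative_map, derivative_expSeries,
      smul_eq_mul, smul_eq_mul, map_mul]
    have : (mk fun n : ℕ => const (t • p (n + 1)) - zpm ((n : ℤ) + 1)) =
        map const (mk fun n : ℕ => t • p (n + 1)) -
          mk fun n : ℕ => zpm ((n : ℤ) + 1) := by
      ext1 n
      simp only [coeff_map, coeff_mk, map_sub]
    rw [this]
    ring
  · have hc (f : Lam →+* Laurent) : constantCoeff (map f (expSeries t)) = 1 := by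
      rw [← coeff_zero_eq_constantCoeff_apply, coeff_map, coeff_zero_eq_constantCoeff_apply,
        constantCoeff_expSeries, map_one]
    simp [map_mul, shiftFactor, hc]

/-- This is the previous case for `-t`, inverted. -/
theorem map_shift_expSeries_mul {s t : ℚ} (hst : t * s = 1) :
    map (shift s) (expSeries t) * shiftFactor = map const (expSeries t) := by
  have h1 := map_shift_expSeries (s := s) (t := -t) (by rw [neg_mul, hst])
  have h2 := congrArg (map (shift s)) (expSeries_mul_neg t)
  have h3 := congrArg (map (const : Lam →+* LaurentSeries Lam)) (expSeries_mul_neg t)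
  rw [map_mul, map_one] at h2 h3
  rw [h1] at h2
  linear_combination (map const (expSeries t)) * h2 -
    map (shift s) (expSeries t) * shiftFactor * h3

theorem shift_expCoeff {s t : ℚ} (hst : t * s = -1) (n : ℤ) :
    shift s (expCoeff t n) = const (expCoeff t n) -
      zpm 1 * const (expCoeff t (n - 1)) + const (expCoeff t (n - 2)) := by
  rcases lt_or_ge n 0 with hn | hn
  · rw [expCoeff_of_neg t hn, expCoeff_of_neg t (show n - 1 < 0 by omega),
      expCoeff_of_neg t (show n - 2 < 0 by omega)]
    simp
  lift n to ℕ using hn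
  have h1 := congrArg (PowerSeries.coeff n) (map_shift_expSeries hst)
  rw [coeff_map, shiftFactor, mul_add, mul_sub, mul_one, mul_left_comm, map_add, map_sub,
    coeff_C_mul, coeff_mul_X_pow', coeff_map] at h1
  rcases n with _ | _ | n
  · rw [expCoeff_of_neg t (show ((0 : ℕ) : ℤ) - 1 < 0 by omega),
      expCoeff_of_neg t (show ((0 : ℕ) : ℤ) - 2 < 0 by omega), expCoeff_natCast, h1]
    simp
  · rw [expCoeff_of_neg t (show ((0 + 1 : ℕ) : ℤ) - 2 < 0 by omega), expCoeff_natCast,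
      show ((0 + 1 : ℕ) : ℤ) - 1 = (0 : ℕ) by norm_num, expCoeff_natCast, h1, coeff_succ_mul_X]
    simp
  · rw [expCoeff_natCast, show ((n + 1 + 1 : ℕ) : ℤ) - 1 = ((n + 1 : ℕ) : ℤ) by push_cast; ring,
      show ((n + 1 + 1 : ℕ) : ℤ) - 2 = (n : ℤ) by push_cast; ring, expCoeff_natCast,
      expCoeff_natCast, h1, coeff_succ_mul_X, if_pos (by omega), coeff_map, coeff_map]
    rfl

/-- The row of coefficients `zpm i`, with the constant term counted once. -/
noncomputable def symmRow (i : ℕ) : Laurent := if i = 0 then 1 else zpm i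

/-- The row satisfies `r_{i+1} = (z + z⁻¹) r_i - r_{i-1}` from `i = 2` on; the initial terms produce
`1 - X ^ 2`. -/
theorem mk_symmRow_mul_shiftFactor : mk symmRow * shiftFactor = 1 - X ^ 2 := by
  ext1 n
  rw [shiftFactor, mul_add, mul_sub, mul_one, mul_left_comm]
  simp only [map_add, map_sub, coeff_C_mul, coeff_mul_X_pow', coeff_mk, coeff_one, coeff_X_pow]
  rcases n with _ | _ | _ | n
  · simp [symmRow]
  · simp [coeff_succ_mul_X, symmRow]
  · simp only [coeff_succ_mul_X, coeff_mk, symmRow]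
    norm_num [zpm_mul_zpm, zpm_zero]
  · simp only [coeff_succ_mul_X, coeff_mk, symmRow]
    rw [if_neg (by omega), if_neg (by omega), if_pos (by omega), if_neg (by omega),
      if_neg (by omega), if_neg (by omega), zpm_mul_zpm, ← zpm_neg (1 - _),
      show 1 + ((n + 1 + 1 : ℕ) : ℤ) = ((n + 1 + 1 + 1 : ℕ) : ℤ) by push_cast; ring,
      show -(1 - ((n + 1 + 1 : ℕ) : ℤ)) = ((n + 1 + 1 + 1 - 2 : ℕ) : ℤ) by
        rw [show n + 1 + 1 + 1 - 2 = n + 1 by omega]; push_cast; ring]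
    ring

/-- The row of coefficients `z ^ (-i) - z ^ (i + 2)`. -/
noncomputable def skewRow (i : ℕ) : Laurent := zpw (-i) - zpw (i + 2)

theorem zpm_mul_skewRow (i : ℕ) : zpm 1 * skewRow (i + 1) = skewRow i + skewRow (i + 2) := by
  simp only [zpm, skewRow, mul_sub, add_mul, zpw_mul_zpw]
  push_cast
  rw [show (1 : ℤ) + -(i + 1) = -i by ring, show (-1 : ℤ) + -(i + 1) = -(i + 2) by ring,
    show (1 : ℤ) + (i + 1 + 2) = i + 2 + 2 by ring, show (-1 : ℤ) + (i + 1 + 2) = i + 2 by ring]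
  ring

theorem zpm_mul_skewRow_zero : zpm 1 * skewRow 0 = skewRow 1 := by
  simp only [zpm, skewRow, mul_sub, add_mul, zpw_mul_zpw]
  norm_num
  ring

/-- The coefficients of `1 / ((1 - z t)(1 - z⁻¹ t))` are `z^(-i) + z^(-i+2) + ⋯ + z^i`; multiplied
by `1 - z^2` they telescope to `skewRow`. -/
theorem mk_skewRow_mul_shiftFactor : mk skewRow * shiftFactor = C (1 - zpw 2) := by
  ext1 n
  rw [shiftFactor, mul_add, mul_sub, mul_one, mul_left_comm]
  simp only [map_add, map_sub, coeff_C_mul, coeff_mul_X_pow', coeff_mk, coeff_C]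
  rcases n with _ | _ | n
  · simp [skewRow, zpw_zero]
  · rw [coeff_succ_mul_X, coeff_mk, zpm_mul_skewRow_zero]
    simp
  · rw [coeff_succ_mul_X, coeff_mk, zpm_mul_skewRow, if_pos (by omega)]
    simp

theorem shift_expCoeff_sub {s t : ℚ} (hst : t * s = 1) (n : ℕ) :
    shift s (expCoeff t n) - shift s (expCoeff t ((n : ℤ) - 2)) =
      ∑ x ∈ Finset.HasAntidiagonal.antidiagonal n, const (expCoeff t x.1) * symmRow x.2 := by
  have h1 : map (shift s) (expSeries t) * (1 - X ^ 2) =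
      map const (expSeries t) * mk symmRow := by
    rw [← map_shift_expSeries_mul hst, ← mk_symmRow_mul_shiftFactor]
    ring
  have h2 := congrArg (PowerSeries.coeff n) h1
  rw [mul_sub, mul_one, map_sub, coeff_mul_X_pow', coeff_map, coeff_mul] at h2
  simp only [coeff_map, coeff_mk, ← expCoeff_natCast] at h2
  rw [← h2]
  congr 1
  split_ifs with hn
  · rw [Nat.cast_sub hn]; rfl
  · rw [expCoeff_of_neg _ (by omega), map_zero]

theorem one_sub_mul_shift_expCoeff {s t : ℚ} (hst : t * s = 1) (n : ℕ) :
    (1 - zpw 2) * shift s (expCoeff t n) =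
      ∑ x ∈ Finset.HasAntidiagonal.antidiagonal n, const (expCoeff t x.1) * skewRow x.2 := by
  have h1 : C (1 - zpw 2) * map (shift s) (expSeries t) =
      map const (expSeries t) * mk skewRow := by
    rw [← map_shift_expSeries_mul hst, ← mk_skewRow_mul_shiftFactor]
    ring
  have h2 := congrArg (PowerSeries.coeff n) h1
  rw [coeff_C_mul, coeff_map, coeff_mul] at h2
  simpa only [coeff_map, coeff_mk, ← expCoeff_natCast] using h2

end GeneratingSeries

/-! ### Column operations and bordered determinants -/

section ColumnOperations

variable {K : Type*} [CommRing K]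

/-- The column operation `f_j ↦ f_j - u f_{j-1} + w_{j-2} f_{j-2}`. -/
def columnOp (u : K) (w : ℕ → K) (f : ℕ → K) : ℕ → K
  | 0 => f 0
  | 1 => f 1 - u * f 0
  | j + 2 => f (j + 2) - u * f (j + 1) + w j * f j

theorem columnOp_eq_sum (u : K) (w f : ℕ → K) {n j : ℕ} (hj : j < n) :
    columnOp u w f j = ∑ l ∈ Finset.range n, f l * columnOp u w (Pi.single l 1) j := by
  rcases j with _ | _ | j
  · simp [columnOp, Pi.single_apply, hj]
  · simp [columnOp, Pi.single_apply, hj, mul_sub, Finset.sum_sub_distrib,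
      show 0 < n by omega, mul_comm]
  · simp [columnOp, Pi.single_apply, hj, mul_sub, mul_add, Finset.sum_sub_distrib,
      Finset.sum_add_distrib, show j + 1 < n by omega, show j < n by omega, mul_comm]

/-- The operation is right multiplication by an upper unitriangular matrix. -/
theorem det_columnOp {n : ℕ} (u : K) (w : ℕ → K) (f : Fin n → ℕ → K) :
    (Matrix.of fun i j : Fin n => columnOp u w (f i) j).det =
      (Matrix.of fun i j : Fin n => f i j).det := by
  have hT : (Matrix.of fun l j : Fin n => columnOp u w (Pi.single (l : ℕ) 1) j).det = 1 := by
    rw [Matrix.det_of_isUpperTriangular]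
    · refine Finset.prod_eq_one fun i _ => ?_
      rcases i with ⟨_ | _ | i, hi⟩ <;> simp [columnOp, Pi.single_apply]
      intro h
      omega
    · rintro ⟨l, hl⟩ ⟨j, hj⟩ hlj
      simp only [id, Fin.mk_lt_mk] at hlj
      rcases j with _ | _ | j
      · simp [columnOp, Pi.single_apply, show 0 ≠ l by omega]
      · simp [columnOp, Pi.single_apply, show 0 ≠ l by omega, show 1 ≠ l by omega]
      · simp [columnOp, Pi.single_apply, show j ≠ l by omega, show j + 1 ≠ l by omega,
          show j + 2 ≠ l by omega]
  rw [← mul_one (Matrix.of fun i j : Fin n => f i j).det, ← hT, ← Matrix.det_mul]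
  congr 1
  ext i j
  rw [Matrix.of_apply, columnOp_eq_sum u w (f i) j.2, Matrix.mul_apply,
    Fin.sum_univ_eq_sum_range (fun l => f i l * columnOp u w (Pi.single l 1) j) n |>.symm]
  rfl

/-- The recurrence says that the column operation kills every entry of the first row except `r 0`;
then expand along that row. -/
theorem det_eq_mul_det_of_recurrence {k : ℕ} (u : K) (w r : ℕ → K) (g : Fin k → ℕ → K)
    (hr0 : r 1 = u * r 0) (hr : ∀ j, r (j + 2) = u * r (j + 1) - w j * r j) :
    (Matrix.of fun i j : Fin (k + 1) => (Fin.cons r g : Fin (k + 1) → ℕ → K) i j).det =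
      r 0 * (Matrix.of fun i j : Fin k => columnOp u w (g i) (j + 1)).det := by
  have hz (j : ℕ) : columnOp u w r (j + 1) = 0 := by
    rcases j with _ | j
    · simp [columnOp, hr0]
    · simp [columnOp, hr]
  rw [← det_columnOp u w, Matrix.det_succ_row_zero, Fin.sum_univ_succ]
  simp only [Matrix.of_apply, Fin.cons_zero, Fin.val_succ, hz, mul_zero, zero_mul,
    Finset.sum_const_zero, add_zero]
  simp only [Fin.val_zero, pow_zero, one_mul, columnOp]
  rfl

end ColumnOperations

/-- Only the first row involves `z`, and the determinant is linear in it. -/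
theorem coeff_det_cons {k : ℕ} (r : ℕ → Laurent) (g : Fin k → ℕ → Lam) (n : ℤ) :
    coeff n (Matrix.of fun i j : Fin (k + 1) =>
        (Fin.cons r (fun i j => const (g i j)) : Fin (k + 1) → ℕ → Laurent) i j).det =
      (Matrix.of fun i j : Fin (k + 1) =>
        (Fin.cons (fun j => coeff n (r j)) g : Fin (k + 1) → ℕ → Lam) i j).det := by
  rw [Matrix.det_succ_row_zero, Matrix.det_succ_row_zero, map_sum]
  refine Finset.sum_congr rfl fun j _ => ?_
  have h1 : ((Matrix.of fun i j : Fin (k + 1) =>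
      (Fin.cons r (fun i j => const (g i j)) : Fin (k + 1) → ℕ → Laurent) i j).submatrix
        Fin.succ j.succAbove).det = const ((Matrix.of fun i j : Fin (k + 1) =>
      (Fin.cons (fun j => coeff n (r j)) g : Fin (k + 1) → ℕ → Lam) i j).submatrix
        Fin.succ j.succAbove).det := by
    rw [RingHom.map_det]
    rfl
  rw [h1, ← map_one const, ← map_neg, ← map_pow, mul_right_comm, ← map_mul, coeff_const_mul,
    mul_right_comm]
  rfl

/-- The common induction step of both determinant formulas. The shift, a ring homomorphism, acts
entrywise; by `hf` its effect is the column operation on the bordered matrix, whose column `0` is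
used up by the border. Hence the index `j + 1`. -/
theorem coeff_mul_shift_det (s : ℚ) {k : ℕ} (w : ℕ → Lam) (r : ℕ → Laurent)
    (f g : Fin k → ℕ → Lam) (hr0 : r 1 = zpm 1 * r 0)
    (hr : ∀ j, r (j + 2) = zpm 1 * r (j + 1) - const (w j) * r j)
    (hf : ∀ i j, shift s (f i j) =
      columnOp (zpm 1) (fun j => const (w j)) (fun j => const (g i j)) (j + 1)) (n : ℤ) :
    coeff n (r 0 * shift s (Matrix.of fun i j : Fin k => f i j).det) =
      (Matrix.of fun i j : Fin (k + 1) =>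
        (Fin.cons (fun j => coeff n (r j)) g : Fin (k + 1) → ℕ → Lam) i j).det := by
  rw [← coeff_det_cons, det_eq_mul_det_of_recurrence (zpm 1) (fun j => const (w j)) r _ hr0 hr,
    RingHom.map_det]
  congr 2
  exact congrArg Matrix.det (Matrix.ext fun i j => hf i j)

/-! ### Products of vertex operators as determinants -/

theorem applyProd_Ystar (k : ℕ) (n : ℕ → ℤ) :
    applyProd Ystar k n 1 = (Matrix.of fun i j : Fin k =>
      expCoeff (-1) (n i - i + j) - expCoeff (-1) (n i - i - j - 2)).det := by
  induction k generalizing n with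
  | zero => simp [applyProd]
  | succ k ih =>
    rw [applyProd, ih, Ystar_eq]
    have h0 : (1 - zpw 2) * expS (-1) = skewRow 0 * expS (-1) := by
      simp [skewRow, zpw_zero]
    rw [h0]
    refine (coeff_mul_shift_det 1 (fun _ => 1) (fun j => skewRow j * expS (-1))
      (fun i j => expCoeff (-1) (n (i + 1) - i + j) - expCoeff (-1) (n (i + 1) - i - j - 2))
      (fun i j => expCoeff (-1) (n (i + 1) - (i + 1) + j) -
        expCoeff (-1) (n (i + 1) - (i + 1) - j - 2)) ?_ ?_ ?_ (n 0)).trans ?_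
    · rw [← mul_assoc, zpm_mul_skewRow_zero]
    · intro j
      rw [← mul_assoc, zpm_mul_skewRow, map_one]
      ring
    · intro i j
      rw [map_sub, shift_expCoeff (by norm_num), shift_expCoeff (by norm_num)]
      -- For `j = 0` the terms without `zpm` at distance two cancel between the two halves of the
      -- entry, matching the two-term form of the operation on column `1`.
      rcases j with _ | j
      · simp only [columnOp, map_sub]
        push_cast
        ring_nf
      · simp only [columnOp, map_sub]
        push_cast
        ring_nf
        simp
    · congr 1
      ext1 i j
      refine Fin.cases ?_ (fun i => ?_) i
      · simp [skewRow, sub_mul, coeff_zpw_mul, coeff_expS]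
        ring_nf
      · simp

theorem symmRow_one : symmRow 1 = zpm 1 * symmRow 0 := by
  simp [symmRow]

/-- The weight `2` at `j = 0` appears because `symmRow 0 = 1` is half of `zpm 0`. -/
theorem symmRow_add_two (j : ℕ) :
    symmRow (j + 2) = zpm 1 * symmRow (j + 1) - const (if j = 0 then 2 else 1) * symmRow j := by
  rcases j with _ | j
  · simp only [symmRow]
    norm_num [zpm_mul_zpm, zpm_zero, map_ofNat]
  · simp only [symmRow]
    rw [if_neg (by omega), if_neg (by omega), if_neg (by omega), if_neg (by omega), zpm_mul_zpm,
      map_one, ← zpm_neg (1 - _)]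
    push_cast
    ring_nf

/-- The entries of the symplectic determinant, with its first column divided by two. -/
noncomputable def symmEntry (b : ℤ) (j : ℕ) : Lam :=
  if j = 0 then h b else h (b + j) + h (b - j)

theorem coeff_symmRow_mul (n : ℤ) (j : ℕ) : coeff n (symmRow j * expS 1) = symmEntry n j := by
  simp only [symmRow, symmEntry]
  split_ifs
  · simp [coeff_expS, expCoeff_one]
  · simp [zpm, add_mul, coeff_zpw_mul, coeff_expS, expCoeff_one]
    ring

theorem applyProd_Y (k : ℕ) (n : ℕ → ℤ) :
    applyProd Y k (fun i => -n i) 1 =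
      (Matrix.of fun i j : Fin k => symmEntry (n i - i) j).det := by
  induction k generalizing n with
  | zero => simp [applyProd]
  | succ k ih =>
    rw [applyProd, ih (fun i => n (i + 1)), Y_eq, neg_neg]
    have h0 : expS 1 = symmRow 0 * expS 1 := by
      simp [symmRow]
    rw [h0]
    refine (coeff_mul_shift_det (-1) (fun j => if j = 0 then 2 else 1)
      (fun j => symmRow j * expS 1)
      (fun i j => symmEntry (n (i + 1) - i) j)
      (fun i j => symmEntry (n (i + 1) - (i + 1)) j) ?_ ?_ ?_ (n 0)).trans ?_
    · rw [← mul_assoc, symmRow_one]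
    · intro j
      rw [symmRow_add_two]
      ring
    · intro i j
      have hs (n : ℤ) := shift_expCoeff (s := -1) (t := 1) (by norm_num) n
      simp only [expCoeff_one] at hs
      rcases j with _ | _ | j
      · simp only [columnOp, symmEntry]
        simp [hs]
        ring_nf
      · simp only [columnOp, symmEntry]
        simp [hs, map_ofNat]
        ring_nf
      · simp only [columnOp, symmEntry]
        simp [hs]
        ring_nf
    · congr 1
      ext1 i j
      refine Fin.cases ?_ (fun i => ?_) i
      · simp [coeff_symmRow_mul]
      · simp

/-! ### The anticommutation relation -/

theorem Y_add (n : ℤ) (f g : Lam) : Y n (f + g) = Y n f + Y n g := by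
  simp only [Y_eq, map_add, mul_add]

theorem Ystar_add (n : ℤ) (f g : Lam) : Ystar n (f + g) = Ystar n f + Ystar n g := by
  simp only [Ystar_eq, map_add, mul_add]

theorem Y_algebraMap_mul (n : ℤ) (c : ℚ) (f : Lam) :
    Y n (algebraMap ℚ Lam c * f) = algebraMap ℚ Lam c * Y n f := by
  simp only [Y_eq, map_mul, shift_algebraMap]
  rw [mul_left_comm, coeff_const_mul]

theorem Ystar_algebraMap_mul (n : ℤ) (c : ℚ) (f : Lam) :
    Ystar n (algebraMap ℚ Lam c * f) = algebraMap ℚ Lam c * Ystar n f := by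
  simp only [Ystar_eq, map_mul, shift_algebraMap]
  rw [mul_left_comm, coeff_const_mul]

theorem Ystar_sub (n : ℤ) (f g : Lam) : Ystar n (f - g) = Ystar n f - Ystar n g := by
  simp only [Ystar_eq, map_sub, mul_sub]

theorem Y_p_mul (m : ℤ) (k : ℕ) (f : Lam) :
    Y m (p (k + 1) * f) = p (k + 1) * Y m f - Y (m + (k + 1)) f - Y (m - (k + 1)) f := by
  simp only [Y_eq, map_mul, shift_p, zpm]
  have (a b c x y : Laurent) : a * ((b + const (algebraMap ℚ Lam (-1)) * (x + y)) * c) =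
      b * (a * c) - x * (a * c) - y * (a * c) := by
    rw [map_neg, map_one, map_neg, map_one]
    ring
  rw [this, map_sub, map_sub, coeff_const_mul, coeff_zpw_mul, coeff_zpw_mul]
  congr 4 <;> ring

theorem Ystar_p_mul (n : ℤ) (k : ℕ) (f : Lam) :
    Ystar n (p (k + 1) * f) =
      p (k + 1) * Ystar n f + Ystar (n - (k + 1)) f + Ystar (n + (k + 1)) f := by
  simp only [Ystar_eq, map_mul, shift_p, zpm]
  have (a b c x y : Laurent) : a * ((b + const (algebraMap ℚ Lam 1) * (x + y)) * c) =
      b * (a * c) + x * (a * c) + y * (a * c) := by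
    rw [map_one, map_one]
    ring
  rw [this, map_add, map_add, coeff_const_mul, coeff_zpw_mul, coeff_zpw_mul]
  congr 4

theorem Y_one (m : ℤ) : Y m 1 = h (-m) := by
  rw [Y_eq, map_one, mul_one, coeff_expS, expCoeff_one]

theorem Ystar_one (n : ℤ) : Ystar n 1 = expCoeff (-1) n - expCoeff (-1) (n - 2) := by
  rw [Ystar_eq, map_one, mul_one, sub_mul, one_mul, map_sub, coeff_zpw_mul, coeff_expS, coeff_expS]

/-- Here `ts = 1`, and the difference in `Ystar n 1` supplies the factor `1 - X ^ 2` that turns the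
shift into `symmRow`. The free bound `N` only adds vanishing terms. -/
theorem Y_Ystar_one (m n : ℤ) {N : ℕ} (hN : n < N) :
    Y m (Ystar n 1) = ∑ i ∈ Finset.range N, expCoeff (-1) (n - i) * symmEntry (-m) i := by
  rw [Ystar_one]
  rcases lt_or_ge n 0 with hn | hn
  · rw [expCoeff_of_neg _ hn, expCoeff_of_neg _ (by omega), Y_eq]
    rw [sub_self, map_zero, mul_zero, map_zero]
    refine (Finset.sum_eq_zero fun i _ => ?_).symm
    rw [expCoeff_of_neg _ (by omega), zero_mul]
  · lift n to ℕ using hn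
    rw [Y_eq, map_sub, shift_expCoeff_sub (by norm_num), Finset.mul_sum, map_sum,
      Finset.Nat.sum_antidiagonal_eq_sum_range_succ_mk, ← Finset.sum_range_reflect]
    rw [← Finset.sum_subset (Finset.range_subset_range.mpr (show n + 1 ≤ N by omega))]
    · refine Finset.sum_congr rfl fun i hi => ?_
      rw [Finset.mem_range] at hi
      rw [mul_left_comm, mul_comm (expS 1), coeff_const_mul, coeff_symmRow_mul,
        show n + 1 - 1 - i = n - i by omega, show n - (n - i) = i by omega, Nat.cast_sub (by omega)]
    · intro i _ hi
      rw [Finset.mem_range] at hi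
      rw [expCoeff_of_neg _ (by omega), zero_mul]

theorem coeff_skewRow_mul (n : ℤ) (j : ℕ) (t : ℚ) :
    coeff n (skewRow j * expS t) = expCoeff t (n + j) - expCoeff t (n - j - 2) := by
  rw [skewRow, sub_mul, map_sub, coeff_zpw_mul, coeff_zpw_mul, coeff_expS, coeff_expS]
  congr 2 <;> ring

/-- Again `ts = 1`; now the prefactor `1 - z^2` turns the shift into `skewRow`. -/
theorem Ystar_h (n k : ℤ) {N : ℕ} (hN : k < N) :
    Ystar n (h k) =
      ∑ i ∈ Finset.range N, h (k - i) * (expCoeff (-1) (n + i) - expCoeff (-1) (n - i - 2)) := by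
  rcases lt_or_ge k 0 with hk | hk
  · rw [h_of_neg hk, Ystar_eq, map_zero, mul_zero, map_zero]
    refine (Finset.sum_eq_zero fun i _ => ?_).symm
    rw [h_of_neg (by omega), zero_mul]
  · lift k to ℕ using hk
    rw [Ystar_eq, mul_right_comm, ← expCoeff_one, one_sub_mul_shift_expCoeff (by norm_num),
      Finset.sum_mul, map_sum,
      Finset.Nat.sum_antidiagonal_eq_sum_range_succ_mk, ← Finset.sum_range_reflect]
    rw [← Finset.sum_subset (Finset.range_subset_range.mpr (show k + 1 ≤ N by omega))]
    · refine Finset.sum_congr rfl fun i hi => ?_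
      rw [Finset.mem_range] at hi
      rw [mul_assoc, coeff_const_mul, coeff_skewRow_mul, expCoeff_one,
        show k + 1 - 1 - i = k - i by omega, show k - (k - i) = i by omega, Nat.cast_sub (by omega)]
    · intro i _ hi
      rw [Finset.mem_range] at hi
      rw [h_of_neg (by omega), zero_mul]

theorem sum_Icc_neg {M : Type*} [AddCommMonoid M] (F : ℤ → M) (N : ℕ) :
    ∑ j ∈ Finset.Icc (-(N : ℤ)) N, F j =
      F 0 + ∑ i ∈ Finset.range N, (F (i + 1) + F (-(i + 1))) := by
  induction N with
  | zero => simp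
  | succ N ih =>
    have : Finset.Icc (-((N + 1 : ℕ) : ℤ)) ((N + 1 : ℕ) : ℤ) =
        insert ((N : ℤ) + 1) (insert (-((N : ℤ) + 1)) (Finset.Icc (-(N : ℤ)) N)) := by
      ext j
      simp only [Finset.mem_Icc, Finset.mem_insert]
      omega
    rw [this, Finset.sum_insert, Finset.sum_insert, ih, Finset.sum_range_succ]
    · abel
    · simp
    · simp only [Finset.mem_Icc, Finset.mem_insert]
      omega

/-- This is the coefficient of degree `n - m` in `H(z)⁻¹ H(z) = 1`. Terms outside `[m, n]` vanish;
the symmetric window is chosen to be folded at `0`. -/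
theorem sum_expCoeff_mul_h (m n : ℤ) {N : ℕ} (hm : m.natAbs ≤ N) (hn : n.natAbs ≤ N) :
    ∑ j ∈ Finset.Icc (-(N : ℤ)) N, expCoeff (-1) (n - j) * h (j - m) =
      if m = n then 1 else 0 := by
  have hsub : Finset.Icc m n ⊆ Finset.Icc (-(N : ℤ)) N :=
    Finset.Icc_subset_Icc (by omega) (by omega)
  rw [← Finset.sum_subset hsub]
  · rcases lt_or_ge n m with hnm | hnm
    · rw [Finset.Icc_eq_empty (by omega), Finset.sum_empty, if_neg (by omega)]
    obtain ⟨d, rfl⟩ : ∃ d : ℕ, n = m + d := ⟨(n - m).toNat, by omega⟩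
    have h1 := congrArg (PowerSeries.coeff d) (expSeries_mul_neg (-1))
    rw [PowerSeries.coeff_mul, neg_neg, PowerSeries.coeff_one] at h1
    simp only [← expCoeff_natCast, expCoeff_one] at h1
    rw [if_congr (show m = m + d ↔ d = 0 by omega) rfl rfl, ← h1]
    refine Finset.sum_bij' (fun j _ => ((m + d - j).toNat, (j - m).toNat))
      (fun x _ => m + x.2) ?_ ?_ ?_ ?_ ?_
    · intro j hj
      rw [Finset.mem_Icc] at hj
      rw [Finset.HasAntidiagonal.mem_antidiagonal]
      simp only
      omega
    · intro x hx
      rw [Finset.HasAntidiagonal.mem_antidiagonal] at hx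
      rw [Finset.mem_Icc]
      omega
    · intro j hj
      rw [Finset.mem_Icc] at hj
      simp only
      omega
    · rintro ⟨x, y⟩ hx
      rw [Finset.HasAntidiagonal.mem_antidiagonal] at hx
      simp only [Prod.mk.injEq] at hx ⊢
      omega
    · intro j hj
      rw [Finset.mem_Icc] at hj
      simp only
      rw [Int.toNat_of_nonneg (by omega), Int.toNat_of_nonneg (by omega)]
  · intro j _ hj
    rw [Finset.mem_Icc, not_and_or] at hj
    rcases hj with hj | hj
    · rw [h_of_neg (by omega), mul_zero]
    · rw [expCoeff_of_neg _ (by omega), zero_mul]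

/-- With `c_n = expCoeff (-1) n`, the cross terms `c_{n-i} h_{-i-m}`, `i ≥ 1`, cancel between the
two products. What is left is `c_{n-j} h_{j-m}` over all `j`: the first product gives `j ≥ 0`, the
second `j < 0`. -/
theorem Y_Ystar_add_Ystar_Y_one (m n : ℤ) :
    Y m (Ystar n 1) + Ystar (n + 1) (Y (m + 1) 1) = if m = n then 1 else 0 := by
  obtain ⟨N, hm, hn⟩ : ∃ N : ℕ, m.natAbs ≤ N ∧ n.natAbs ≤ N := ⟨_, le_max_left _ _, le_max_right _ _⟩
  rw [Y_one, Y_Ystar_one m n (N := N + 1) (by omega), Ystar_h (n + 1) _ (N := N) (by omega),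
    ← sum_expCoeff_mul_h m n hm hn, sum_Icc_neg, Finset.sum_range_succ', add_right_comm,
    ← Finset.sum_add_distrib, add_comm]
  congr 1
  · simp [symmEntry]
  · refine Finset.sum_congr rfl fun i _ => ?_
    rw [symmEntry, if_neg (by omega)]
    push_cast
    rw [show -(m + 1) - (i : ℤ) = -(i + 1) - m by ring, show n + 1 + (i : ℤ) = n - -(i + 1) by ring,
      show n + 1 - (i : ℤ) - 2 = n - (i + 1) by ring, show -m + ((i : ℤ) + 1) = i + 1 - m by ring,
      show -m - ((i : ℤ) + 1) = -(i + 1) - m by ring]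
    ring

/-- The anticommutation relation of the vertex operators. -/
theorem Y_Ystar_add_Ystar_Y (m n : ℤ) (f : Lam) :
    Y m (Ystar n f) + Ystar (n + 1) (Y (m + 1) f) = if m = n then f else 0 := by
  induction f using induction_p generalizing m n with
  | const c =>
    rw [← mul_one (algebraMap ℚ Lam c), Ystar_algebraMap_mul, Y_algebraMap_mul, Y_algebraMap_mul,
      Ystar_algebraMap_mul, ← mul_add, Y_Ystar_add_Ystar_Y_one, mul_ite, mul_zero]
  | add f g hf hg =>
    rw [Ystar_add, Y_add, Y_add, Ystar_add, add_add_add_comm, hf, hg]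
    split_ifs <;> simp
  | mul_p k f ih =>
    obtain ⟨k, rfl⟩ : ∃ j : ℕ, k = j.succPNat := ⟨k.natPred, by simp⟩
    rw [Nat.succPNat_coe, Nat.succ_eq_add_one, Ystar_p_mul, Y_add, Y_add, Y_p_mul, Y_p_mul,
      Ystar_sub, Ystar_sub, Ystar_p_mul]
    have h0 := ih m n
    have h1 := ih (m + (k + 1)) n
    have h2 := ih (m - (k + 1)) n
    have h3 := ih m (n - (k + 1))
    have h4 := ih m (n + (k + 1))
    rw [show m + ((k : ℤ) + 1) + 1 = m + 1 + (k + 1) by ring] at h1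
    rw [show m - ((k : ℤ) + 1) + 1 = m + 1 - (k + 1) by ring] at h2
    rw [show n - ((k : ℤ) + 1) + 1 = n + 1 - (k + 1) by ring] at h3
    rw [show n + ((k : ℤ) + 1) + 1 = n + 1 + (k + 1) by ring] at h4
    -- Raising `m` or lowering `n` by `k + 1` gives the same Kronecker delta, and likewise in the
    -- other direction, so the four shifted relations cancel in pairs.
    rw [if_congr (show m + ((k : ℤ) + 1) = n ↔ m = n - (k + 1) by omega) rfl rfl] at h1
    rw [if_congr (show m - ((k : ℤ) + 1) = n ↔ m = n + (k + 1) by omega) rfl rfl] at h2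
    rw [← mul_zero (p (k + 1)), ← mul_ite, ← h0]
    linear_combination h3 + h4 - h1 - h2

/-! ### Exchanging rows for columns -/

theorem Y_zero_one : Y 0 1 = 1 := by
  rw [Y_one, neg_zero, h_zero]

theorem Ystar_zero_one : Ystar 0 1 = 1 := by
  rw [Ystar_one, expCoeff_zero, expCoeff_of_neg _ (by norm_num), sub_zero]

theorem algebraMap_neg_one_pow (c : ℕ) : algebraMap ℚ Lam ((-1) ^ c) = (-1) ^ c := by
  rw [map_pow, map_neg, map_one]

theorem neg_one_pow_mul_self (c : ℕ) : (-1 : Lam) ^ c * (-1) ^ c = 1 := by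
  rw [← algebraMap_neg_one_pow, ← map_mul, ← mul_pow, neg_mul_neg, one_mul, one_pow, map_one]

theorem Y_neg_one_pow_mul (n : ℤ) (c : ℕ) (f : Lam) : Y n ((-1) ^ c * f) = (-1) ^ c * Y n f := by
  rw [← algebraMap_neg_one_pow, Y_algebraMap_mul]

theorem Ystar_neg_one_pow_mul (n : ℤ) (c : ℕ) (f : Lam) :
    Ystar n ((-1) ^ c * f) = (-1) ^ c * Ystar n f := by
  rw [← algebraMap_neg_one_pow, Ystar_algebraMap_mul]

theorem applyProd_congr (A : ℤ → Lam → Lam) {k : ℕ} {n n' : ℕ → ℤ} (hn : ∀ i < k, n i = n' i)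
    (f : Lam) : applyProd A k n f = applyProd A k n' f := by
  induction k generalizing n n' with
  | zero => rfl
  | succ k ih =>
    rw [applyProd, applyProd, hn 0 (by omega), ih fun i hi => hn (i + 1) (by omega)]

theorem applyProd_add (A : ℤ → Lam → Lam) (k l : ℕ) (n : ℕ → ℤ) (f : Lam) :
    applyProd A (k + l) n f = applyProd A k n (applyProd A l (fun i => n (i + k)) f) := by
  induction k generalizing n with
  | zero => simp [applyProd]
  | succ k ih =>
    rw [show k + 1 + l = k + l + 1 by ring, applyProd, applyProd, ih]
    rfl

theorem applyProd_zero_one (A : ℤ → Lam → Lam) (hA : A 0 1 = 1) (k : ℕ) :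
    applyProd A k (fun _ => 0) 1 = 1 := by
  induction k with
  | zero => rfl
  | succ k ih => rw [applyProd, ih, hA]

theorem applyProd_eq_of_le (A : ℤ → Lam → Lam) (hA : A 0 1 = 1) {k l : ℕ} (hkl : k ≤ l)
    {n : ℕ → ℤ} (hn : ∀ i, k ≤ i → n i = 0) : applyProd A l n 1 = applyProd A k n 1 := by
  obtain ⟨l, rfl⟩ := Nat.exists_eq_add_of_le hkl
  rw [applyProd_add, applyProd_congr A (k := l) (n' := fun _ => 0) (fun i _ => hn _ (by omega)),
    applyProd_zero_one A hA]

theorem applyProd_neg_one_pow_mul {A : ℤ → Lam → Lam}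
    (hA : ∀ n c f, A n ((-1) ^ c * f) = (-1) ^ c * A n f) (k : ℕ) (n : ℕ → ℤ) (c : ℕ) (f : Lam) :
    applyProd A k n ((-1) ^ c * f) = (-1) ^ c * applyProd A k n f := by
  induction k generalizing n with
  | zero => rfl
  | succ k ih => rw [applyProd, ih, hA, applyProd]

/-- Each exchange lowers the index of `Ystar` by one, lengthens a row by one and changes the sign;
after `c` exchanges `Ystar 0` meets `1` and disappears. The delta vanishes because `-(a 0 + 1) < 0 ≤
c`. -/
theorem Ystar_applyProd_Y (c : ℕ) (a : ℕ → ℕ) :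
    Ystar c (applyProd Y c (fun i => -(a i : ℤ)) 1) =
      (-1) ^ c * applyProd Y c (fun i => -((a i + 1 : ℕ) : ℤ)) 1 := by
  induction c generalizing a with
  | zero => simp [applyProd, Ystar_zero_one]
  | succ c ih =>
    have h1 := Y_Ystar_add_Ystar_Y (-((a 0 + 1 : ℕ) : ℤ)) c
      (applyProd Y c (fun i => -(a (i + 1) : ℤ)) 1)
    rw [if_neg (by omega), ih (fun i => a (i + 1)), Y_neg_one_pow_mul] at h1
    rw [show -((a 0 + 1 : ℕ) : ℤ) + 1 = -(a 0 : ℤ) by push_cast; ring] at h1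
    rw [applyProd, applyProd, Nat.cast_succ]
    linear_combination h1

/-- The hypothesis `hab` makes `a` and `b` conjugate partitions. Induct on columns: deleting the
first column replaces `a i` by `a i - 1` and drops `b 0`, and `Ystar_applyProd_Y` puts the column
back. -/
theorem applyProd_Y_eq_applyProd_Ystar {a b : ℕ → ℕ} (hab : ∀ i j, j < a i ↔ i < b j) {k l : ℕ}
    (hk : b 0 ≤ k) (hl : a 0 ≤ l) :
    applyProd Y k (fun i => -(a i : ℤ)) 1 =
      (-1) ^ (∑ j ∈ Finset.range l, b j) * applyProd Ystar l (fun j => (b j : ℤ)) 1 := by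
  induction l generalizing a b k with
  | zero =>
    have hb : b 0 = 0 := by
      by_contra h
      have := (hab 0 0).mpr (by omega)
      omega
    have ha (i : ℕ) : a i = 0 := by
      by_contra h
      have := (hab i 0).mp (by omega)
      omega
    simp only [ha, Nat.cast_zero, neg_zero, applyProd_zero_one Y Y_zero_one, applyProd,
      Finset.range_zero, Finset.sum_empty, pow_zero, one_mul]
  | succ l ih =>
    have ha (i : ℕ) (hi : b 0 ≤ i) : a i = 0 := by
      by_contra h
      have := (hab i 0).mp (by omega)
      omega
    have hb : b 1 ≤ b 0 := by
      by_contra! h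
      have h1 := (hab (b 0) 1).mpr h
      have h2 := (hab (b 0) 0).mp (by omega)
      omega
    have h1 := ih (a := fun i => a i - 1) (b := fun j => b (j + 1)) (k := b 0)
      (fun i j => by rw [← hab]; omega) hb (by omega)
    have h2 := Ystar_applyProd_Y (b 0) (fun i => a i - 1)
    rw [h1, Ystar_neg_one_pow_mul] at h2
    rw [applyProd_eq_of_le Y Y_zero_one hk (fun i hi => by simp [ha i hi]), applyProd,
      Finset.sum_range_succ', pow_add, mul_right_comm, h2, mul_right_comm, neg_one_pow_mul_self,
      one_mul]
    refine applyProd_congr Y (fun i hi => ?_) 1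
    have := (hab i 0).mpr hi
    rw [Nat.sub_add_cancel this]

/-! ### Young diagrams and the Durfee square -/

theorem card_eq_sum_rowLen (μ : YoungDiagram) {k : ℕ} (hk : μ.colLen 0 ≤ k) :
    μ.card = ∑ i ∈ Finset.range k, μ.rowLen i := by
  have hmaps : ∀ c ∈ μ.cells, c.1 ∈ Finset.range k := by
    intro c hc
    rw [YoungDiagram.mem_cells] at hc
    have h0 : (c.1, 0) ∈ μ := μ.up_left_mem le_rfl (Nat.zero_le _) hc
    rw [YoungDiagram.mem_iff_lt_colLen] at h0
    rw [Finset.mem_range]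
    omega
  rw [YoungDiagram.card, Finset.card_eq_sum_card_fiberwise hmaps]
  exact Finset.sum_congr rfl fun i _ => by rw [YoungDiagram.rowLen_eq_card, YoungDiagram.row]

/-- The diagonal cells form an initial segment of the diagonal, so counting them finds the first one
missing. -/
theorem mem_diag_iff (μ : YoungDiagram) (i : ℕ) : (i, i) ∈ μ ↔ i < diagLen μ := by
  have hex : ∃ d, (d, d) ∉ μ := ⟨μ.colLen 0, fun hc => by
    have h0 : (μ.colLen 0, 0) ∈ μ := μ.up_left_mem le_rfl (Nat.zero_le _) hc
    rw [YoungDiagram.mem_iff_lt_colLen] at h0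
    exact lt_irrefl _ h0⟩
  classical
  have hmem (i : ℕ) : (i, i) ∈ μ ↔ i < Nat.find hex := by
    constructor
    · intro hi
      by_contra! h
      exact Nat.find_spec hex (μ.up_left_mem h h hi)
    · intro hi
      exact not_not.mp (Nat.find_min hex hi)
  have hcard : diagLen μ = Nat.find hex := by
    rw [← Finset.card_range (Nat.find hex), diagLen]
    symm
    refine Finset.card_bij (fun i _ => (i, i)) ?_ ?_ ?_
    · intro i hi
      rw [Finset.mem_filter, YoungDiagram.mem_cells, hmem]
      exact ⟨Finset.mem_range.mp hi, rfl⟩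
    · intro i _ j _ hij
      exact congrArg Prod.fst hij
    · rintro ⟨i, j⟩ hij
      rw [Finset.mem_filter, YoungDiagram.mem_cells] at hij
      obtain ⟨hij, rfl : i = j⟩ := hij
      exact ⟨i, Finset.mem_range.mpr ((hmem i).mp hij), rfl⟩
  rw [hmem, hcard]

theorem diagLen_le_rowLen (μ : YoungDiagram) {i : ℕ} (hi : i < diagLen μ) :
    diagLen μ ≤ μ.rowLen i := by
  have h1 := (mem_diag_iff μ (diagLen μ - 1)).mpr (by omega)
  have h2 : (i, diagLen μ - 1) ∈ μ := μ.up_left_mem (by omega) le_rfl h1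
  rw [YoungDiagram.mem_iff_lt_rowLen] at h2
  omega

theorem diagLen_le_colLen (μ : YoungDiagram) {i : ℕ} (hi : i < diagLen μ) :
    diagLen μ ≤ μ.colLen i := by
  have h1 := (mem_diag_iff μ (diagLen μ - 1)).mpr (by omega)
  have h2 : (diagLen μ - 1, i) ∈ μ := μ.up_left_mem le_rfl (by omega) h1
  rw [YoungDiagram.mem_iff_lt_colLen] at h2
  omega

theorem rowLen_diagLen_le (μ : YoungDiagram) : μ.rowLen (diagLen μ) ≤ diagLen μ := by
  by_contra! h
  rw [← YoungDiagram.mem_iff_lt_rowLen, mem_diag_iff] at h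
  exact lt_irrefl _ h

theorem colLen_diagLen_le (μ : YoungDiagram) : μ.colLen (diagLen μ) ≤ diagLen μ := by
  by_contra! h
  rw [← YoungDiagram.mem_iff_lt_colLen, mem_diag_iff] at h
  exact lt_irrefl _ h

theorem rowLen_eq_zero {μ : YoungDiagram} {i : ℕ} (hi : μ.colLen 0 ≤ i) : μ.rowLen i = 0 := by
  by_contra h
  have h0 : (i, 0) ∈ μ := YoungDiagram.mem_iff_lt_rowLen.mpr (by omega)
  rw [YoungDiagram.mem_iff_lt_colLen] at h0
  omega

/-! ### Signs, normalization and the Frobenius formulas -/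

theorem expCoeff_neg_one_eq (n : ℤ) (N : ℕ) (hN : (N : ℤ) % 2 = n % 2) :
    expCoeff (-1) n = (-1) ^ N * e n := by
  rw [expCoeff_neg_one, Algebra.smul_def, ← algebraMap_neg_one_pow]
  congr 2
  obtain ⟨c, hc⟩ : ∃ c, n = N + 2 * c := ⟨(n - N) / 2, by omega⟩
  rw [hc, zpow_add₀ (by norm_num), zpow_mul]
  simp

/-- The sign of an entry is `(-1)^(n i + i)` from its row times `(-1)^j` from its column; in the
total the contributions of `i` and `j` cancel. -/
theorem applyProd_Ystar_eq_det_e (k : ℕ) (n : ℕ → ℕ) :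
    applyProd Ystar k (fun i => (n i : ℤ)) 1 =
      (-1) ^ (∑ i ∈ Finset.range k, n i) * (Matrix.of fun i j : Fin k =>
        e ((n i : ℤ) - ((i : ℤ) + 1) + ((j : ℤ) + 1)) -
          e ((n i : ℤ) - ((i : ℤ) + 1) - ((j : ℤ) + 1))).det := by
  have hsign : (-1 : Lam) ^ (∑ i ∈ Finset.range k, n i) =
      (∏ i : Fin k, (-1) ^ (n i + i : ℕ)) * ∏ j : Fin k, (-1) ^ (j : ℕ) := by
    rw [← Finset.prod_mul_distrib,
      Fin.prod_univ_eq_prod_range (fun i : ℕ => (-1 : Lam) ^ (n i + i : ℕ) * (-1) ^ i),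
      ← Finset.prod_pow_eq_pow_sum]
    refine Finset.prod_congr rfl fun i _ => ?_
    rw [pow_add, mul_assoc, neg_one_pow_mul_self, mul_one]
  rw [applyProd_Ystar, hsign, mul_assoc, ← Matrix.det_mul_row, ← Matrix.det_mul_column]
  congr 1
  ext1 i j
  simp only [Matrix.of_apply]
  rw [expCoeff_neg_one_eq _ (n i + i + j) (by push_cast; omega),
    expCoeff_neg_one_eq _ (n i + i + j) (by push_cast; omega), pow_add (-1) (n i + i : ℕ)]
  rw [show (n i : ℤ) - ((i : ℕ) + 1) + ((j : ℕ) + 1) = n i - (i : ℕ) + (j : ℕ) by ring,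
    show (n i : ℤ) - ((i : ℕ) + 1) - ((j : ℕ) + 1) = n i - (i : ℕ) - (j : ℕ) - 2 by ring]
  ring

/-- In the first column both summands coincide, giving the factor `2` that `1 / 2` removes; this is
where `1 ≤ k` is needed. -/
theorem half_det_h_eq_applyProd_Y {k : ℕ} (hk : 1 ≤ k) (n : ℕ → ℤ) :
    (1 / 2 : ℚ) • (Matrix.of fun i j : Fin k =>
      h (n i - ((i : ℤ) + 1) + ((j : ℤ) + 1)) +
        h (n i - ((i : ℤ) + 1) - ((j : ℤ) + 1) + 2)).det =
      applyProd Y k (fun i => -n i) 1 := by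
  obtain ⟨k, rfl⟩ := Nat.exists_eq_add_of_le' hk
  have hprod : ∏ j : Fin (k + 1), (if (j : ℕ) = 0 then 2 else 1 : Lam) = algebraMap ℚ Lam 2 := by
    rw [Fin.prod_univ_succ, map_ofNat]
    simp
  have hdet : (Matrix.of fun i j : Fin (k + 1) =>
      h (n i - ((i : ℤ) + 1) + ((j : ℤ) + 1)) +
        h (n i - ((i : ℤ) + 1) - ((j : ℤ) + 1) + 2)).det =
      algebraMap ℚ Lam 2 * applyProd Y (k + 1) (fun i => -n i) 1 := by
    rw [applyProd_Y, ← hprod, ← Matrix.det_mul_row]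
    congr 1
    ext1 i j
    simp only [Matrix.of_apply, symmEntry]
    rw [show n i - (((i : ℕ) : ℤ) + 1) + ((j : ℕ) + 1) = n i - (i : ℕ) + (j : ℕ) by ring,
      show n i - (((i : ℕ) : ℤ) + 1) - ((j : ℕ) + 1) + 2 = n i - (i : ℕ) - (j : ℕ) by ring]
    split_ifs with hj
    · rw [hj]
      simp [two_mul]
    · rw [one_mul]
  rw [hdet, ← Algebra.smul_def, smul_smul]
  norm_num

theorem sp_eq_applyProd_Y (μ : YoungDiagram) {k : ℕ} (hk : μ.colLen 0 ≤ k) :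
    sp μ = applyProd Y k (fun i => -(μ.rowLen i : ℤ)) 1 := by
  have hz (i : ℕ) (hi : μ.colLen 0 ≤ i) : -(μ.rowLen i : ℤ) = 0 := by
    rw [rowLen_eq_zero hi, Nat.cast_zero, neg_zero]
  rw [sp, half_det_h_eq_applyProd_Y (le_max_left _ _) fun i => (μ.rowLen i : ℤ),
    applyProd_eq_of_le Y Y_zero_one (le_max_right _ _) hz, applyProd_eq_of_le Y Y_zero_one hk hz]

theorem lt_rowLen_iff_lt_colLen (μ : YoungDiagram) (i j : ℕ) : j < μ.rowLen i ↔ i < μ.colLen j := by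
  rw [← YoungDiagram.mem_iff_lt_rowLen, YoungDiagram.mem_iff_lt_colLen]

theorem sp_eq_applyProd_Ystar (μ : YoungDiagram) {l : ℕ} (hl : μ.rowLen 0 ≤ l) :
    sp μ = (-1) ^ (∑ j ∈ Finset.range l, μ.colLen j) *
      applyProd Ystar l (fun j => (μ.colLen j : ℤ)) 1 := by
  rw [sp_eq_applyProd_Y μ le_rfl,
    applyProd_Y_eq_applyProd_Ystar (lt_rowLen_iff_lt_colLen μ) le_rfl hl]

theorem sum_frobB_add (μ : YoungDiagram) (r : ℕ) (hr : r = diagLen μ) :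
    ∑ i ∈ Finset.range r, frobB μ i =
      (∑ i ∈ Finset.range r, (μ.colLen i - r)) + r * (r - 1) / 2 := by
  rw [← Finset.sum_range_id, ← Finset.sum_range_reflect (fun i => i), ← Finset.sum_add_distrib]
  refine Finset.sum_congr rfl fun i hi => ?_
  rw [Finset.mem_range] at hi
  have := diagLen_le_colLen μ (hr ▸ hi)
  rw [frobB]
  omega

theorem sum_colLen_eq (μ : YoungDiagram) (r : ℕ) (hr : r = diagLen μ) :
    ∑ i ∈ Finset.range r, μ.colLen i =
      (∑ i ∈ Finset.range r, frobB μ i) + r * (r + 1) / 2 := by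
  have h1 : r * (r + 1) / 2 = ∑ i ∈ Finset.range r, (i + 1) := by
    have := Finset.sum_range_id (r + 1)
    rw [Finset.sum_range_succ', Nat.add_sub_cancel, mul_comm, add_zero] at this
    exact this.symm
  rw [h1, ← Finset.sum_add_distrib]
  refine Finset.sum_congr rfl fun i hi => ?_
  rw [Finset.mem_range] at hi
  have := diagLen_le_colLen μ (hr ▸ hi)
  rw [frobB]
  omega

/-- Keep `Y` for the first `r` rows and dualize the rows below the Durfee square, whose columns have
lengths `μ.colLen j - r`. The sign agrees because `r (r - 1) / 2` enters twice. -/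
theorem sp_eq_Y_Ystar (μ : YoungDiagram) (r : ℕ) (hr : r = diagLen μ) :
    sp μ = (-1) ^ ((∑ i ∈ Finset.range r, frobB μ i) + r * (r - 1) / 2) *
      applyProd Y r (fun i => -(frobA μ i : ℤ) - ((i : ℤ) + 1))
        (applyProd Ystar r (fun i => (frobB μ i : ℤ) - ((r : ℤ) - ((i : ℤ) + 1))) 1) := by
  have hrow : ∀ i < r, -(frobA μ i : ℤ) - ((i : ℤ) + 1) = -(μ.rowLen i : ℤ) := by
    intro i hi
    have := diagLen_le_rowLen μ (hr ▸ hi)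
    rw [frobA]
    omega
  have hcol : ∀ i < r, (frobB μ i : ℤ) - ((r : ℤ) - ((i : ℤ) + 1)) =
      ((μ.colLen i - r : ℕ) : ℤ) := by
    intro i hi
    have := diagLen_le_colLen μ (hr ▸ hi)
    rw [frobB]
    omega
  have hdual := applyProd_Y_eq_applyProd_Ystar (a := fun i => μ.rowLen (i + r))
    (b := fun j => μ.colLen j - r) (k := μ.colLen 0) (l := r)
    (fun i j => by rw [lt_rowLen_iff_lt_colLen]; omega) (Nat.sub_le _ _)
    (by rw [zero_add, hr]; exact rowLen_diagLen_le μ)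
  rw [applyProd_congr Y hrow, applyProd_congr Ystar hcol,
    sp_eq_applyProd_Y μ (Nat.le_add_left (μ.colLen 0) r), applyProd_add, hdual,
    applyProd_neg_one_pow_mul Y_neg_one_pow_mul, sum_frobB_add μ r hr, add_assoc, pow_add _ _ (_ + _),
    pow_add _ (_ / 2), neg_one_pow_mul_self, mul_one]

/-- Keep `Ystar` for the first `r` columns and turn the columns to the right of the Durfee square
back into rows, of lengths `μ.rowLen i - r`. -/
theorem sp_eq_Ystar_Y (μ : YoungDiagram) (r : ℕ) (hr : r = diagLen μ) :
    sp μ = (-1) ^ ((∑ i ∈ Finset.range r, frobB μ i) + r * (r + 1) / 2) *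
      applyProd Ystar r (fun i => (frobB μ i : ℤ) + ((i : ℤ) + 1))
        (applyProd Y r (fun i => -(frobA μ i : ℤ) + ((r : ℤ) - ((i : ℤ) + 1))) 1) := by
  have hrow : ∀ i < r, -(frobA μ i : ℤ) + ((r : ℤ) - ((i : ℤ) + 1)) =
      -((μ.rowLen i - r : ℕ) : ℤ) := by
    intro i hi
    have := diagLen_le_rowLen μ (hr ▸ hi)
    rw [frobA]
    omega
  have hcol : ∀ i < r, (frobB μ i : ℤ) + ((i : ℤ) + 1) = (μ.colLen i : ℤ) := by
    intro i hi
    have := diagLen_le_colLen μ (hr ▸ hi)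
    rw [frobB]
    omega
  have hdual := applyProd_Y_eq_applyProd_Ystar (a := fun i => μ.rowLen i - r)
    (b := fun j => μ.colLen (j + r)) (k := r) (l := μ.rowLen 0)
    (fun i j => by rw [← lt_rowLen_iff_lt_colLen]; omega)
    (by rw [zero_add, hr]; exact colLen_diagLen_le μ) (Nat.sub_le _ _)
  rw [applyProd_congr Ystar hcol, applyProd_congr Y hrow, hdual,
    applyProd_neg_one_pow_mul Ystar_neg_one_pow_mul, ← sum_colLen_eq μ r hr,
    sp_eq_applyProd_Ystar μ (Nat.le_add_left (μ.rowLen 0) r), applyProd_add, Finset.sum_range_add,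
    pow_add, mul_assoc]
  simp only [add_comm]

end SymFun

theorem theoremT (μ : YoungDiagram) :
    -- the product `Y*_{μ_1} ⋯ Y*_{μ_k}.1`, for `μ` written with `k` parts, trailing zeros allowed
    (∀ k : ℕ, μ.colLen 0 ≤ k →
      SymFun.applyProd SymFun.Ystar k (fun i => (μ.rowLen i : ℤ)) 1 =
        (-1) ^ μ.card * (Matrix.of fun i j : Fin k =>
          SymFun.e ((μ.rowLen i : ℤ) - ((i : ℤ) + 1) + ((j : ℤ) + 1)) -
            SymFun.e ((μ.rowLen i : ℤ) - ((i : ℤ) + 1) - ((j : ℤ) + 1))).det) ∧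
    -- the two determinants for `sp_μ`, of arbitrary admissible sizes
    (∀ k : ℕ, 1 ≤ k → μ.colLen 0 ≤ k →
      SymFun.sp μ = (1 / 2 : ℚ) • (Matrix.of fun i j : Fin k =>
          SymFun.h ((μ.rowLen i : ℤ) - ((i : ℤ) + 1) + ((j : ℤ) + 1)) +
            SymFun.h ((μ.rowLen i : ℤ) - ((i : ℤ) + 1) - ((j : ℤ) + 1) + 2)).det) ∧
    (∀ l : ℕ, μ.transpose.colLen 0 ≤ l →
      SymFun.sp μ = (Matrix.of fun i j : Fin l =>
          SymFun.e ((μ.transpose.rowLen i : ℤ) - ((i : ℤ) + 1) + ((j : ℤ) + 1)) -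
            SymFun.e ((μ.transpose.rowLen i : ℤ) - ((i : ℤ) + 1) - ((j : ℤ) + 1))).det) ∧
    -- the two mixed products, for `μ = (α | β)` in Frobenius notation
    (∀ r : ℕ, r = SymFun.diagLen μ →
      SymFun.sp μ = (-1) ^ ((∑ i ∈ Finset.range r, SymFun.frobB μ i) + r * (r - 1) / 2) *
        SymFun.applyProd SymFun.Y r
          (fun i => -(SymFun.frobA μ i : ℤ) - ((i : ℤ) + 1))
          (SymFun.applyProd SymFun.Ystar r
            (fun i => (SymFun.frobB μ i : ℤ) - ((r : ℤ) - ((i : ℤ) + 1))) 1) ∧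
      SymFun.sp μ = (-1) ^ ((∑ i ∈ Finset.range r, SymFun.frobB μ i) + r * (r + 1) / 2) *
        SymFun.applyProd SymFun.Ystar r
          (fun i => (SymFun.frobB μ i : ℤ) + ((i : ℤ) + 1))
          (SymFun.applyProd SymFun.Y r
            (fun i => -(SymFun.frobA μ i : ℤ) + ((r : ℤ) - ((i : ℤ) + 1))) 1)) := by
  refine ⟨fun k hk => ?_, fun k hk1 hk => ?_, fun l hl => ?_,
    fun r hr => ⟨SymFun.sp_eq_Y_Ystar μ r hr, SymFun.sp_eq_Ystar_Y μ r hr⟩⟩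
  · rw [SymFun.card_eq_sum_rowLen μ hk]
    exact SymFun.applyProd_Ystar_eq_det_e k μ.rowLen
  · rw [SymFun.sp_eq_applyProd_Y μ hk]
    exact (SymFun.half_det_h_eq_applyProd_Y hk1 fun i => (μ.rowLen i : ℤ)).symm
  · have h1 := SymFun.applyProd_Ystar_eq_det_e l μ.transpose.rowLen
    rw [YoungDiagram.colLen_transpose] at hl
    rw [SymFun.sp_eq_applyProd_Ystar μ hl]
    simp only [YoungDiagram.rowLen_transpose] at h1 ⊢
    -- Duality and the determinant formula contribute the same sign, the parity of the sum of the
    -- column lengths.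
    rw [h1, ← mul_assoc, SymFun.neg_one_pow_mul_self, one_mul]
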